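/- For integers $0\le m\le q$, $0\le n\le p$ and complex parameters $a_1,\dots,a_p$, $b_1,\dots,b_q$ such that $a_i-b_j$ is not a positive integer for $i\le n$, $j\le m$, the Meijer $G$-function is $$G^{m,n}_{p,q}\Big({a_1,\dots,a_p\atop b_1,\dots,b_q}\Big|z\Big)=\frac1{2\pi i}\int_L z^s\,\frac{\prod_{l=1}^m\Gamma(b_l-s)\prod_{l=1}^n\Gamma(1-a_l+s)}{\prod_{l=m+1}^q\Gamma(1-b_l+s)\prod_{l=n+1}^p\Gamma(a_l-s)}\,ds,\qquad z\neq0,$$ where a value of $\log z$ (hence of $\arg z$ and of $z^s=e^{s\log z}$) is fixed and the path $L$ separates the poles of the $\Gamma(b_l-s)$, $l\le m$, from those of the $\Gamma(1-a_l+s)$, $l\le n$. Here $L$ is of one of the following kinds (piecewise $C^1$, with ends on straight lines parallel to the indicated direction): (i) from $-i\infty$ to $i\infty$, with the poles of the $\Gamma(1-a_l+s)$ on its left and those of the $\Gamma(b_l-s)$ on its right, if $p+q<2(m+n)$ and $|\arg z|<(m+n-\tfrac12(p+q))\pi$; (ii) a loop from and to $+\infty$ encircling the poles of the $\Gamma(b_l-s)$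 once in the negative sense and not encircling the other poles, if $p<q$, or $p=q\ge1$ and $|z|<1$; (iii) a loop from and to $-\infty$ encircling the poles of the $\Gamma(1-a_l+s)$ once in the positive sense and not encircling the other poles, if $p>q$, or $p=q\ge1$ and $|z|>1$. **Proposition.** Let $p\ge n\ge0$, $q\ge m\ge0$ and let $\boldsymbol a=(a_1,\dots,a_{p+1})$, $\boldsymbol b=(b_1,\dots,b_{q+1})$ be complex parameters such that $a_{n+1}-b_{m+1}=k$ is a positive integer, while $a_i-b_j$ is not a positive integer for all other pairs $(i,j)$ with $1\le i\le n+1$, $1\le j\le m+1$. Let $z\neq0$ with a fixed value of $\log z$. Then, for any paths $L_1$ and $L_2$ as above for $G^{m,n+1}_{p+1,q+1}$ and $G^{m+1,n}_{p+1,q+1}$ respectively, the integrals defining these two functions at $z$ converge absolutely and $$G^{m,n+1}_{p+1,q+1}\Big({\boldsymbol a\atop\boldsymbol b}\Big|z\Big)-(-1)^{k}\,G^{m+1,n}_{p+1,q+1}\Big({\boldsymbol a\atop\boldsymbol b}\Big|z\Big)=\sum_{c}(-1)^{a_{n+1}-1-c}\,\frac{\prod_{l=1}^m\Gamma(b_l-c)\prod_{l=1}^n\Gamma(1-a_l+c)}{\prod_{l=m+1}^{q+1}\Gamma(1-b_l+c)\prod_{l=n+1}^{p+1}\Gamma(a_l-c)}\,z^c,$$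 where $c$ runs over $b_{m+1},\,b_{m+1}+1,\,\dots,\,a_{n+1}-1$ in integer steps. -/

import Mathlib

open scoped BigOperators Topology

noncomputable section

namespace MeijerG

/-- The Mellin-Barnes integrand of `G^{m,n}_{p,q}` with upper parameters `a_1, …, a_p` and lower
parameters `b_1, …, b_q` (`a_l` is `a ⟨l - 1, _⟩`, `b_l` is `b ⟨l - 1, _⟩`) at the point `s`:
`z^s ∏_{l ≤ m} Γ(b_l - s) ∏_{l ≤ n} Γ(1 - a_l + s) / (∏_{l > m} Γ(1 - b_l + s) ∏_{l > n} Γ(a_l - s))`.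
The power `z^s` of the argument `z ≠ 0` depends on a choice of `log z`. The variable `ω` is that
choice: `z = exp ω`, `arg z = ω.im`, `|z| = exp ω.re` and `z^s = exp (s * ω)`. The principal branch
is `ω = Complex.log z`. -/
def integrand (m n : ℕ) {p q : ℕ} (a : Fin p → ℂ) (b : Fin q → ℂ) (ω s : ℂ) : ℂ :=
  Complex.exp (s * ω) *
    (((∏ l : Fin q with l.val < m, Complex.Gamma (b l - s)) *
        (∏ l : Fin p with l.val < n, Complex.Gamma (1 - a l + s))) /
      ((∏ l : Fin q with m ≤ l.val, Complex.Gamma (1 - b l + s)) *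
        (∏ l : Fin p with n ≤ l.val, Complex.Gamma (a l - s))))

/-- The poles of the factors `Γ(1 - a_l + s)`, `1 ≤ l ≤ n`, of the integrand. -/
def leftPoles (n : ℕ) {p : ℕ} (a : Fin p → ℂ) : Set ℂ :=
  {s | ∃ l : Fin p, l.val < n ∧ ∃ r : ℕ, s = a l - 1 - r}

/-- The poles of the factors `Γ(b_l - s)`, `1 ≤ l ≤ m`, of the integrand. -/
def rightPoles (m : ℕ) {q : ℕ} (b : Fin q → ℂ) : Set ℂ :=
  {s | ∃ l : Fin q, l.val < m ∧ ∃ r : ℕ, s = b l + r}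

/-- Piecewise continuously differentiable curves (with locally bounded derivative). -/
def IsPiecewiseC1 (γ : ℝ → ℂ) : Prop :=
  LocallyLipschitz γ ∧ ∃ S : Set ℝ, S.Finite ∧ ∀ t, t ∉ S → ContDiffAt ℝ 1 γ t

/-- The curve `γ` avoids the point `w`, and `arg (γ t - w)` changes in total by `θ` when `t` runs
from `-∞` to `∞`. -/
def ArgChange (γ : ℝ → ℂ) (w : ℂ) (θ : ℝ) : Prop :=
  (∀ t, γ t ≠ w) ∧
    Filter.Tendsto (fun R : ℝ => (∫ t in (-R)..R, deriv γ t / (γ t - w)).im)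
      Filter.atTop (𝓝 θ)

/-- `γ` goes from `-i∞` to `i∞`, with both ends on lines parallel to the imaginary axis. -/
def IsVertical (γ : ℝ → ℂ) : Prop :=
  ∃ x₁ x₂ T : ℝ, (∀ t, t ≤ -T → γ t = x₁ + t * Complex.I) ∧
    (∀ t, T ≤ t → γ t = x₂ + t * Complex.I)

/-- `γ` starts at infinity on a line parallel to the positive real axis and returns to infinity on
another such line. -/
def IsRightLoop (γ : ℝ → ℂ) : Prop :=
  ∃ y₁ y₂ T : ℝ, (∀ t : ℝ, t ≤ -T → γ t = -t + y₁ * Complex.I) ∧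
    (∀ t : ℝ, T ≤ t → γ t = t + y₂ * Complex.I)

/-- `γ` starts at infinity on a line parallel to the negative real axis and returns to infinity on
another such line. -/
def IsLeftLoop (γ : ℝ → ℂ) : Prop :=
  ∃ y₁ y₂ T : ℝ, (∀ t : ℝ, t ≤ -T → γ t = t + y₁ * Complex.I) ∧
    (∀ t : ℝ, T ≤ t → γ t = -t + y₂ * Complex.I)

/-- The integration paths of the Mellin-Barnes integral that defines `G^{m,n}_{p,q}` at
`z = exp ω`. They separate the poles of the `Γ(b_l - s)` from those of the `Γ(1 - a_l + s)`.
There are three kinds: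

* from `-i∞` to `i∞`, when `p + q < 2 (m + n)` and `|arg z| < (m + n - (p + q) / 2) π`. A point lies
  to the left of such a path if `arg (γ t - w)` increases by `π`, to the right if it decreases
  by `π`;
* a loop from and to `+∞` that encircles the poles of the `Γ(b_l - s)` once in the negative sense
  and does not encircle the others, when `p < q`, or `p = q ≥ 1` and `|z| < 1`;
* a loop from and to `-∞` that encircles the poles of the `Γ(1 - a_l + s)` once in the positive
  sense and does not encircle the others, when `q < p`, or `p = q ≥ 1` and `1 < |z|`. -/
def IsContour (m n : ℕ) {p q : ℕ} (a : Fin p → ℂ) (b : Fin q → ℂ) (ω : ℂ) (γ : ℝ → ℂ) : Prop :=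
  IsPiecewiseC1 γ ∧
    ((IsVertical γ ∧
        p + q < 2 * (m + n) ∧
        |ω.im| < ((m : ℝ) + n - ((p : ℝ) + q) / 2) * Real.pi ∧
        (∀ w ∈ leftPoles n a, ArgChange γ w Real.pi) ∧
        (∀ w ∈ rightPoles m b, ArgChange γ w (-Real.pi))) ∨
      (IsRightLoop γ ∧
        (p < q ∨ (p = q ∧ 1 ≤ p ∧ ‖Complex.exp ω‖ < 1)) ∧
        (∀ w ∈ leftPoles n a, ArgChange γ w 0) ∧
        (∀ w ∈ rightPoles m b, ArgChange γ w (-(2 * Real.pi)))) ∨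
      (IsLeftLoop γ ∧
        (q < p ∨ (p = q ∧ 1 ≤ p ∧ 1 < ‖Complex.exp ω‖)) ∧
        (∀ w ∈ leftPoles n a, ArgChange γ w (2 * Real.pi)) ∧
        (∀ w ∈ rightPoles m b, ArgChange γ w 0)))

/-- The Mellin-Barnes integral along `γ` converges (absolutely). -/
def Converges (m n : ℕ) {p q : ℕ} (a : Fin p → ℂ) (b : Fin q → ℂ) (ω : ℂ) (γ : ℝ → ℂ) : Prop :=
  MeasureTheory.Integrable (fun t : ℝ => integrand m n a b ω (γ t) * deriv γ t)

/-- The Meijer function `G^{m,n}_{p,q}(a; b | z)` at `z = exp ω`, as the Mellin-Barnes integral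
`(2πi)⁻¹ ∫_γ` of the integrand along the integration path `γ`. -/
def meijerG (m n : ℕ) {p q : ℕ} (a : Fin p → ℂ) (b : Fin q → ℂ) (ω : ℂ) (γ : ℝ → ℂ) : ℂ :=
  (2 * Real.pi * Complex.I)⁻¹ * ∫ t : ℝ, integrand m n a b ω (γ t) * deriv γ t

end MeijerG

end

/-! ### Growth of Gamma quotients in right half-planes, from the beta integral. -/

noncomputable section
namespace MeijerG

open MeasureTheory ProbabilityTheory Set

/-! Since `a_{n+1} - b_{m+1} = k`, the recurrence of Γ turns both `Γ(1 - a_{n+1} + s) / Γ(1 -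
b_{m+1} + s)` and `(-1)^k Γ(b_{m+1} - s) / Γ(a_{n+1} - s)` into `1 / ∏_{i<k} (s - b_{m+1} - i)`. Up
to the sign `(-1)^k` the two integrands are therefore one function `g`
(`integrand_eq_divByRoots_left`, `integrand_eq_divByRoots_right`). The points `c = b_{m+1} + i`, `i
< k`, count as left poles for the first path and as right poles for the second; at every other pole
of `g` the two paths agree. The difference of the integrals is thus `2πi` times the sum of the
residues at the points `c`. These are at most simple poles, because the condition on the remaining
pairs keeps them away from the poles of the common factor, and partial fractions give the residues
(`nodalWeight_mul_commonFactor`).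

The paths are arbitrary curves, possibly of different kinds, so nothing is deformed. In a strip, `g`
is a derivative plus finitely many simple fractions (`exists_hasResidues_divByRoots`), and the
integral of a simple fraction along a path is controlled by the prescribed change of argument
(`logDefect_eq`). Closing a path by a distant vertical line expresses its integral as a weighted sum
of residues (`ClosesToRight`). After subtracting `δ = π` for a vertical path and `δ = 0` for a right
loop, the weights are 0 at left poles and `-2π` at right poles for both kinds, so the unknown
residues at the other poles cancel (`integral_sub_integral_divByRoots`).

The closing line contributes nothing in the limit by `expPolyBound_integrand`: Euler's reflection
formula rewrites the integrand through sines and quotients `Γ(s + α) / Γ(s + β)`, and the beta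
integral bounds the latter. With `P` upper and `Q` lower parameters this needs `P < Q`, or `P = Q`
and `|z| < 1`. If `P = Q` and `|z| = 1`, both paths are vertical and one common line, not sent to
infinity, is enough. The remaining cases follow by `s ↦ -s`, which exchanges the roles of `a` and
`b` (`connection_formula`). -/

theorem norm_betaIntegral_le {u v : ℂ} {x : ℝ} (hx : 0 < x) (hxu : x ≤ u.re) (hv : 0 < v.re) :
    ‖Complex.betaIntegral u v‖ ≤ beta x v.re := by
  have hg := Complex.betaIntegral_convergent (u := x) (v := v.re) (by simpa) (by simpa)
  rw [beta_eq_betaIntegralReal x v.re hx hv]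
  have hre : (Complex.betaIntegral x v.re).re = ∫ t : ℝ in (0 : ℝ)..1,
      ((t : ℂ) ^ ((x : ℂ) - 1) * (1 - (t : ℂ)) ^ ((v.re : ℂ) - 1)).re :=
    (Complex.reCLM.intervalIntegral_comp_comm hg).symm
  rw [hre]
  refine intervalIntegral.norm_integral_le_of_norm_le zero_le_one ?_
    ((intervalIntegrable_iff_integrableOn_Ioc_of_le zero_le_one).2
      (Complex.reCLM.integrable_comp hg.1))
  filter_upwards [compl_mem_ae_iff.2 (measure_singleton (1 : ℝ))] with t ht1 ht
  have h0 : 0 < t := ht.1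
  have h1 : 0 < 1 - t := sub_pos.2 (lt_of_le_of_ne ht.2 ht1)
  have e1 : (t : ℂ) ^ ((x : ℂ) - 1) = ((t ^ (x - 1) : ℝ) : ℂ) := by
    rw [Complex.ofReal_cpow h0.le]; push_cast; rfl
  have e2 : (1 - (t : ℂ)) ^ ((v.re : ℂ) - 1) = (((1 - t) ^ (v.re - 1) : ℝ) : ℂ) := by
    rw [Complex.ofReal_cpow h1.le]; push_cast; rfl
  have e3 : ‖(1 - (t : ℂ)) ^ (v - 1)‖ = (1 - t) ^ (v.re - 1) := by
    rw [← Complex.ofReal_one, ← Complex.ofReal_sub, Complex.norm_cpow_eq_rpow_re_of_pos h1]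
    simp
  rw [e1, e2, ← Complex.ofReal_mul, Complex.ofReal_re, norm_mul, e3,
    Complex.norm_cpow_eq_rpow_re_of_pos h0]
  refine mul_le_mul_of_nonneg_right ?_ (Real.rpow_nonneg h1.le _)
  exact Real.rpow_le_rpow_of_exponent_ge h0 ht.2 (by simpa using hxu)

/-- Replaces Stirling's formula: for fixed `t`, the quotient `Γ(s) / Γ(s + t)` is bounded uniformly
in `re s ≥ x`, because it is a beta integral divided by `Γ(t)`. -/
theorem norm_Gamma_mul_norm_Gamma_le {s t : ℂ} {x : ℝ} (hx : 0 < x) (hs : x ≤ s.re)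
    (ht : 0 < t.re) :
    ‖Complex.Gamma s‖ * ‖Complex.Gamma t‖ ≤ ‖Complex.Gamma (s + t)‖ * beta x t.re := by
  rw [← norm_mul, Complex.Gamma_mul_Gamma_eq_betaIntegral (hx.trans_le hs) ht, norm_mul]
  exact mul_le_mul_of_nonneg_left (norm_betaIntegral_le hx hs ht) (norm_nonneg _)

/-- Euler's reflection formula gives `|Γ(1 + iy)|² = π|y| / sinh(π|y|)`, and `sinh u ≤ u exp u`. -/
theorem exp_le_norm_Gamma_one_add_mul_I (y : ℝ) :
    Real.exp (-(Real.pi / 2 * |y|)) ≤ ‖Complex.Gamma (1 + y * Complex.I)‖ := by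
  rcases eq_or_ne y 0 with rfl | hy
  · simp
  have hyI : (y : ℂ) * Complex.I ≠ 0 := by simp [hy]
  have hconj : Complex.Gamma (1 - y * Complex.I) =
      (starRingEnd ℂ) (Complex.Gamma (1 + y * Complex.I)) := by
    rw [← Complex.Gamma_conj]; simp [sub_eq_add_neg]
  have key : ‖Complex.Gamma (1 + y * Complex.I)‖ ^ 2 * Real.sinh (Real.pi * |y|) =
      Real.pi * |y| := by
    have h := Complex.Gamma_mul_Gamma_one_sub (y * Complex.I)
    have h1 := Complex.Gamma_add_one _ hyI
    rw [add_comm] at h1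
    have hs : ‖Complex.sin (Real.pi * (y * Complex.I))‖ = Real.sinh (Real.pi * |y|) := by
      rw [← mul_assoc, Complex.sin_mul_I, norm_mul, Complex.norm_I, mul_one,
        ← Complex.ofReal_mul, ← Complex.ofReal_sinh, Complex.norm_real, Real.norm_eq_abs,
        Real.abs_sinh, abs_mul, abs_of_pos Real.pi_pos]
    have hpos : 0 < Real.sinh (Real.pi * |y|) :=
      Real.sinh_pos_iff.2 (mul_pos Real.pi_pos (abs_pos.2 hy))
    have h2 : ‖Complex.Gamma (1 + y * Complex.I)‖ ^ 2 =
        |y| * ‖Complex.Gamma (y * Complex.I) * Complex.Gamma (1 - y * Complex.I)‖ := by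
      rw [norm_mul, hconj, RCLike.norm_conj, sq]
      nth_rewrite 1 [h1]
      simp [mul_assoc]
    rw [h2, h, norm_div, hs, Complex.norm_real, Real.norm_of_nonneg Real.pi_pos.le]
    field_simp
  set u := Real.pi * |y| with hu
  have hu0 : 0 < u := mul_pos Real.pi_pos (abs_pos.2 hy)
  have hsinh : Real.sinh u ≤ u * Real.exp u := by
    have h1 : 1 - 2 * u ≤ Real.exp (-(2 * u)) := by
      have := Real.add_one_le_exp (-(2 * u)); linarith
    have h2 : Real.exp (-u) = Real.exp u * Real.exp (-(2 * u)) := by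
      rw [← Real.exp_add]; ring_nf
    rw [Real.sinh_eq, h2]
    nlinarith [Real.exp_pos u]
  have hsq : Real.exp (-u) ≤ ‖Complex.Gamma (1 + y * Complex.I)‖ ^ 2 := by
    have hA : u ≤ ‖Complex.Gamma (1 + y * Complex.I)‖ ^ 2 * (u * Real.exp u) := by
      exact key.symm.le.trans (mul_le_mul_of_nonneg_left hsinh (by positivity))
    rw [Real.exp_neg, inv_le_iff_one_le_mul₀ (Real.exp_pos u)]
    nlinarith
  have h3 : Real.exp (-(Real.pi / 2 * |y|)) ^ 2 = Real.exp (-u) := by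
    rw [sq, ← Real.exp_add, hu]; ring_nf
  exact (sq_le_sq₀ (Real.exp_pos _).le (norm_nonneg _)).1 (h3 ▸ hsq)

/-- The beta bound with arguments `1 + i im s` and `re s - 1` reduces the lower bound for `|Γ(s)|`
to the line `re s = 1`. -/
theorem norm_inv_Gamma_le {s : ℂ} (hs : 1 ≤ s.re) :
    ‖(Complex.Gamma s)⁻¹‖ ≤ Real.exp (Real.pi / 2 * |s.im|) * (Real.Gamma s.re)⁻¹ := by
  have hG : 0 < Real.Gamma s.re := Real.Gamma_pos_of_pos (by linarith)
  have hlow : Real.exp (-(Real.pi / 2 * |s.im|)) * Real.Gamma s.re ≤ ‖Complex.Gamma s‖ := by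
    have h0 := exp_le_norm_Gamma_one_add_mul_I s.im
    rcases hs.eq_or_lt with h1 | h1
    · have : s = 1 + s.im * Complex.I := by
        apply Complex.ext <;> simp [← h1]
      rw [← h1, Real.Gamma_one, mul_one]
      rwa [← this] at h0
    · have hy : 0 < s.re - 1 := by linarith
      have hGy := Real.Gamma_pos_of_pos hy
      have h2 := norm_Gamma_mul_norm_Gamma_le (s := 1 + s.im * Complex.I)
        (t := ((s.re - 1 : ℝ) : ℂ)) one_pos (by simp) (by simpa using h1)
      have e : 1 + s.im * Complex.I + ((s.re - 1 : ℝ) : ℂ) = s := by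
        apply Complex.ext <;> simp
      rw [e, Complex.Gamma_ofReal, Complex.norm_real, Complex.ofReal_re, beta, Real.Gamma_one,
        add_sub_cancel, one_mul, Real.norm_of_nonneg hGy.le, mul_div_assoc',
        le_div_iff₀ hG] at h2
      have h3 : ‖Complex.Gamma (1 + s.im * Complex.I)‖ * Real.Gamma s.re ≤ ‖Complex.Gamma s‖ := by
        refine le_of_mul_le_mul_right ?_ hGy
        linarith
      exact (mul_le_mul_of_nonneg_right h0 hG.le).trans h3
  rw [norm_inv]
  calc ‖Complex.Gamma s‖⁻¹ ≤ (Real.exp (-(Real.pi / 2 * |s.im|)) * Real.Gamma s.re)⁻¹ :=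
        inv_anti₀ (by positivity) hlow
    _ = _ := by rw [mul_inv, ← Real.exp_neg, neg_neg]

/-- Already the part of Euler's integral over `[M, M + 1]` is at least a constant times `M ^ (x -
1)`; take `M = exp K`. -/
theorem exists_inv_Gamma_le_exp (K : ℝ) :
    ∃ C : ℝ, 0 ≤ C ∧ ∀ x : ℝ, 1 ≤ x → (Real.Gamma x)⁻¹ ≤ C * Real.exp (-K * x) := by
  set M := Real.exp K with hM
  have hM0 : 0 < M := Real.exp_pos K
  refine ⟨Real.exp (M + 1) * M, by positivity, fun x hx => ?_⟩
  have hlow : Real.exp (-(M + 1)) * M ^ (x - 1) ≤ Real.Gamma x := by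
    rw [Real.Gamma_eq_integral (by linarith)]
    have hint := Real.GammaIntegral_convergent (s := x) (by linarith)
    have hsub : Ioc M (M + 1) ⊆ Ioi 0 := fun t ht => hM0.trans ht.1
    calc Real.exp (-(M + 1)) * M ^ (x - 1)
        = ∫ _ in Ioc M (M + 1), Real.exp (-(M + 1)) * M ^ (x - 1) := by simp
      _ ≤ ∫ t in Ioc M (M + 1), Real.exp (-t) * t ^ (x - 1) := by
        refine setIntegral_mono_on (integrableOn_const (by simp)) (hint.mono_set hsub) measurableSet_Ioc ?_
        intro t ht
        refine mul_le_mul (Real.exp_le_exp.2 (by linarith [ht.2]))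
          (Real.rpow_le_rpow hM0.le ht.1.le (by linarith)) (by positivity) (Real.exp_pos _).le
      _ ≤ ∫ t in Ioi 0, Real.exp (-t) * t ^ (x - 1) := by
        refine setIntegral_mono_set hint ?_ hsub.eventuallyLE
        filter_upwards [ae_restrict_mem measurableSet_Ioi] with t ht
        exact mul_nonneg (Real.exp_pos _).le (Real.rpow_nonneg (le_of_lt ht) _)
  have hMx : M ^ (x - 1) = Real.exp (K * x) / M := by
    rw [hM, ← Real.exp_mul, ← Real.exp_sub]; ring_nf
  calc (Real.Gamma x)⁻¹ ≤ (Real.exp (-(M + 1)) * M ^ (x - 1))⁻¹ := inv_anti₀ (by positivity) hlow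
    _ = Real.exp (M + 1) * M * Real.exp (-K * x) := by
      rw [hMx, neg_mul, Real.exp_neg, Real.exp_neg (K * x)]
      field_simp

/-- On `D` the function `h` is bounded by a power of `1 + ‖s‖` times `exp (u * re s + v * |im s|)`. -/
def ExpPolyBound (D : Set ℂ) (h : ℂ → ℂ) (u v : ℝ) : Prop :=
  ∃ (C : ℝ) (A : ℕ), 0 ≤ C ∧
    ∀ s ∈ D, ‖h s‖ ≤ C * (1 + ‖s‖) ^ A * Real.exp (u * s.re + v * |s.im|)

namespace ExpPolyBound

variable {D : Set ℂ} {h h' : ℂ → ℂ} {u v u' v' : ℝ}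

theorem mul (H : ExpPolyBound D h u v) (H' : ExpPolyBound D h' u' v') :
    ExpPolyBound D (fun s => h s * h' s) (u + u') (v + v') := by
  obtain ⟨C, A, hC, hb⟩ := H
  obtain ⟨C', A', hC', hb'⟩ := H'
  refine ⟨C * C', A + A', mul_nonneg hC hC', fun s hs => ?_⟩
  rw [norm_mul]
  refine (mul_le_mul (hb s hs) (hb' s hs) (norm_nonneg _) (by positivity)).trans_eq ?_
  have e : Real.exp ((u + u') * s.re + (v + v') * |s.im|) =
      Real.exp (u * s.re + v * |s.im|) * Real.exp (u' * s.re + v' * |s.im|) := by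
    rw [← Real.exp_add]; ring_nf
  rw [e, pow_add]
  ring

theorem of_norm_le (H : ExpPolyBound D h u v) (hle : ∀ s ∈ D, ‖h' s‖ ≤ ‖h s‖) :
    ExpPolyBound D h' u v := by
  obtain ⟨C, A, hC, hb⟩ := H
  exact ⟨C, A, hC, fun s hs => (hle s hs).trans (hb s hs)⟩

theorem of_norm_le_exp {C : ℝ} (hC : 0 ≤ C)
    (hle : ∀ s ∈ D, ‖h s‖ ≤ C * Real.exp (u * s.re + v * |s.im|)) : ExpPolyBound D h u v :=
  ⟨C, 0, hC, fun s hs => by simpa using hle s hs⟩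

theorem const (c : ℂ) : ExpPolyBound D (fun _ => c) 0 0 :=
  of_norm_le_exp (norm_nonneg c) (by simp)

theorem prod {ι : Type*} (S : Finset ι) {f : ι → ℂ → ℂ}
    (H : ∀ i ∈ S, ExpPolyBound D (f i) u v) :
    ExpPolyBound D (fun s => ∏ i ∈ S, f i s) (S.card * u) (S.card * v) := by
  classical
  induction S using Finset.induction_on with
  | empty => simpa using const (D := D) 1
  | insert i S hi ih =>
    have := (H i (Finset.mem_insert_self i S)).mul
      (ih fun j hj => H j (Finset.mem_insert_of_mem hj))
    simp only [Finset.prod_insert hi, Finset.card_insert_of_notMem hi]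
    convert this using 1 <;> push_cast <;> ring

end ExpPolyBound

theorem expPolyBound_affine_pow (D : Set ℂ) {c : ℝ} (hc : 0 ≤ c) (J : ℕ) (h : ℂ → ℂ)
    (hle : ∀ s ∈ D, ‖h s‖ ≤ (‖s‖ + c) ^ J) : ExpPolyBound D h 0 0 := by
  refine ⟨(1 + c) ^ J, J, by positivity, fun s hs => (hle s hs).trans ?_⟩
  simp only [zero_mul, add_zero, Real.exp_zero, mul_one]
  rw [← mul_pow]
  refine pow_le_pow_left₀ (by positivity) ?_ J
  nlinarith [norm_nonneg s, mul_nonneg hc (norm_nonneg s)]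

/-- `Γ(z + r)` is `Γ(z)` times the factors `z + j`, all of modulus at least 1 here. -/
theorem norm_Gamma_le_norm_Gamma_add_nat (r : ℕ) {z : ℂ} (hz : 1 ≤ z.re ∨ 1 ≤ |z.im|) :
    ‖Complex.Gamma z‖ ≤ ‖Complex.Gamma (z + r)‖ := by
  induction r with
  | zero => simp
  | succ r ih =>
    have hn : 1 ≤ ‖z + r‖ := by
      rcases hz with hz | hz
      · refine le_trans ?_ ((le_abs_self _).trans (Complex.abs_re_le_norm _))
        simp only [Complex.add_re, Complex.natCast_re]
        linarith [(Nat.cast_nonneg r : (0 : ℝ) ≤ r)]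
      · exact le_trans (by simpa using hz) (Complex.abs_im_le_norm _)
    have h0 : z + r ≠ 0 := fun h => by simp [h] at hn; linarith
    push_cast
    rw [← add_assoc, Complex.Gamma_add_one _ h0, norm_mul]
    exact ih.trans (le_mul_of_one_le_left (norm_nonneg _) hn)

theorem inv_Gamma_eq_prod_mul_inv_Gamma_add_nat (z : ℂ) (J : ℕ) :
    (Complex.Gamma z)⁻¹ = (∏ j ∈ Finset.range J, (z + j)) * (Complex.Gamma (z + J))⁻¹ := by
  induction J with
  | zero => simp
  | succ J ih =>
    rw [ih, Complex.one_div_Gamma_eq_self_mul_one_div_Gamma_add_one, Finset.prod_range_succ]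
    push_cast
    ring_nf

theorem norm_prod_add_nat_le (s β : ℂ) (J : ℕ) :
    ‖∏ j ∈ Finset.range J, (s + β + j)‖ ≤ (‖s‖ + (‖β‖ + J)) ^ J := by
  rw [norm_prod]
  refine (Finset.prod_le_prod (g := fun _ => ‖s‖ + (‖β‖ + J)) (fun _ _ => norm_nonneg _)
    fun j hj => ?_).trans (by simp)
  refine (norm_add₃_le).trans ?_
  have : (j : ℝ) ≤ J := by exact_mod_cast (Finset.mem_range.1 hj).le
  simp only [Complex.norm_natCast]
  linarith

/-- Both arguments are shifted by integers until the beta bound applies: the numerator to real part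
at least 1, the denominator until the difference `t` of the arguments has positive real part. Only
the shift of the denominator costs anything, namely a polynomial. -/
theorem expPolyBound_Gamma_div_Gamma {D : Set ℂ} {B : ℝ} (hB : ∀ s ∈ D, -B ≤ s.re) (α β : ℂ)
    (hα : ∀ s ∈ D, 1 ≤ (s + α).re ∨ 1 ≤ |(s + α).im|) :
    ExpPolyBound D (fun s => Complex.Gamma (s + α) * (Complex.Gamma (s + β))⁻¹) 0 0 := by
  obtain ⟨r, hr⟩ := exists_nat_ge (1 + B - α.re)
  obtain ⟨J, hJ⟩ := exists_nat_gt (α.re + r - β.re)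
  set t : ℂ := β + J - α - r with ht
  have htre : 0 < t.re := by simp [ht]; linarith
  have hGt : 0 < ‖Complex.Gamma t‖ :=
    norm_pos_iff.2 (Complex.Gamma_ne_zero_of_re_pos htre)
  have H1 := expPolyBound_affine_pow D (c := ‖β‖ + J) (by positivity) J
    (fun s => ∏ j ∈ Finset.range J, (s + β + j)) (fun s _ => norm_prod_add_nat_le s β J)
  have H2 : ExpPolyBound D
      (fun s => Complex.Gamma (s + α) * (Complex.Gamma (s + β + J))⁻¹) 0 0 := by
    refine ExpPolyBound.of_norm_le_exp (C := beta 1 t.re / ‖Complex.Gamma t‖)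
      (div_nonneg (beta_pos one_pos htre).le hGt.le) fun s hs => ?_
    have hre : 1 ≤ (s + α + r).re := by
      have := hB s hs; simp; linarith
    have h1 := norm_Gamma_le_norm_Gamma_add_nat r (hα s hs)
    have h2 := norm_Gamma_mul_norm_Gamma_le one_pos hre htre
    have e : s + α + r + t = s + β + J := by rw [ht]; ring
    rw [e] at h2
    have hpos : 0 < ‖Complex.Gamma (s + β + J)‖ := by
      refine norm_pos_iff.2 (Complex.Gamma_ne_zero_of_re_pos ?_)
      rw [← e, Complex.add_re]; linarith
    simp only [zero_mul, add_zero, Real.exp_zero, mul_one]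
    rw [norm_mul, norm_inv, ← div_eq_mul_inv, div_le_div_iff₀ hpos hGt]
    calc _ ≤ ‖Complex.Gamma (s + α + r)‖ * ‖Complex.Gamma t‖ :=
          mul_le_mul_of_nonneg_right h1 hGt.le
      _ ≤ _ := by linarith
  have H := H1.mul H2
  simp only [add_zero] at H
  refine H.of_norm_le fun s _ => le_of_eq ?_
  rw [inv_Gamma_eq_prod_mul_inv_Gamma_add_nat (s + β) J]
  congr 1; ring

theorem expPolyBound_inv_Gamma {D : Set ℂ} {B : ℝ} (hB : ∀ s ∈ D, -B ≤ s.re) (β : ℂ) (K : ℝ) :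
    ExpPolyBound D (fun s => (Complex.Gamma (s + β))⁻¹) (-K) (Real.pi / 2) := by
  obtain ⟨J, hJ⟩ := exists_nat_ge (1 + B - β.re)
  obtain ⟨C, hC0, hC⟩ := exists_inv_Gamma_le_exp K
  have H1 := expPolyBound_affine_pow D (c := ‖β‖ + J) (by positivity) J
    (fun s => ∏ j ∈ Finset.range J, (s + β + j)) (fun s _ => norm_prod_add_nat_le s β J)
  have H2 : ExpPolyBound D (fun s => (Complex.Gamma (s + β + J))⁻¹) (-K) (Real.pi / 2) := by
    refine ExpPolyBound.of_norm_le_exp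
      (C := C * Real.exp (Real.pi / 2 * |β.im| + -K * (β.re + J))) (by positivity) fun s hs => ?_
    have hre : 1 ≤ (s + β + J).re := by
      have := hB s hs; simp; linarith
    refine (norm_inv_Gamma_le hre).trans ?_
    have h1 := hC _ hre
    have him : |(s + β + J).im| ≤ |s.im| + |β.im| := by simpa using abs_add_le s.im β.im
    calc _ ≤ Real.exp (Real.pi / 2 * (|s.im| + |β.im|)) *
          (C * Real.exp (-K * (s + β + J).re)) := by
          refine mul_le_mul (Real.exp_le_exp.2 ?_) h1
            (inv_nonneg.2 (Real.Gamma_nonneg_of_nonneg (by linarith))) (Real.exp_pos _).le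
          exact mul_le_mul_of_nonneg_left him (by positivity)
      _ = _ := by
        rw [mul_left_comm, mul_assoc, ← Real.exp_add, ← Real.exp_add]
        simp only [Complex.add_re, Complex.natCast_re]
        ring_nf
  have H := H1.mul H2
  simp only [zero_add] at H
  exact H.of_norm_le fun s _ => le_of_eq (by
    rw [inv_Gamma_eq_prod_mul_inv_Gamma_add_nat (s + β) J])

theorem norm_sin_le_exp (z : ℂ) : ‖Complex.sin z‖ ≤ Real.exp |z.im| := by
  have h1 : ‖Complex.exp (-z * Complex.I)‖ ≤ Real.exp |z.im| := by
    rw [Complex.norm_exp]; simpa using le_abs_self z.im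
  have h2 : ‖Complex.exp (z * Complex.I)‖ ≤ Real.exp |z.im| := by
    rw [Complex.norm_exp]; simpa using neg_le_abs z.im
  rw [Complex.sin, norm_div, norm_mul, Complex.norm_I, mul_one, Complex.norm_two,
    div_le_iff₀ two_pos]
  exact (norm_sub_le _ _).trans (by linarith)

theorem expPolyBound_sin (D : Set ℂ) (c : ℂ) :
    ExpPolyBound D (fun s => Complex.sin (Real.pi * (c - s))) 0 Real.pi := by
  refine ExpPolyBound.of_norm_le_exp (Real.exp_pos (Real.pi * |c.im|)).le fun s _ => ?_
  refine (norm_sin_le_exp _).trans ?_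
  rw [← Real.exp_add, Real.exp_le_exp]
  have : |(Real.pi * (c - s)).im| = Real.pi * |c.im - s.im| := by
    simp [abs_mul, abs_of_pos Real.pi_pos]
  have h2 : |c.im - s.im| ≤ |c.im| + |s.im| := by
    simpa [sub_eq_add_neg] using abs_add_le c.im (-s.im)
  rw [this]
  nlinarith [Real.pi_pos]

theorem expPolyBound_exp (D : Set ℂ) (ω : ℂ) :
    ExpPolyBound D (fun s => Complex.exp (s * ω)) ω.re |ω.im| := by
  refine ExpPolyBound.of_norm_le_exp zero_le_one fun s _ => ?_
  rw [Complex.norm_exp, one_mul, Real.exp_le_exp, Complex.mul_re, mul_comm ω.re, ← abs_mul]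
  have := neg_le_abs (ω.im * s.im)
  linarith

end MeijerG
end

/-! ### Lower bounds for the sine and the growth of the integrand. -/

noncomputable section
namespace MeijerG

open MeasureTheory Set

theorem abs_sin_re_mul_exp_le_norm_sin (z : ℂ) :
    |Real.sin z.re| / 2 * Real.exp |z.im| ≤ ‖Complex.sin z‖ := by
  have h1 : (Complex.sin z).re = Real.sin z.re * Real.cosh z.im := by
    rw [Complex.sin_eq]
    simp [← Complex.ofReal_sin, ← Complex.ofReal_cos, ← Complex.ofReal_cosh, ← Complex.ofReal_sinh]
  have h2 : Real.exp |z.im| / 2 ≤ Real.cosh z.im := by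
    rw [← Real.cosh_abs, Real.cosh_eq]
    linarith [Real.exp_pos (-|z.im|)]
  refine le_trans ?_ (Complex.abs_re_le_norm _)
  rw [h1, abs_mul, abs_of_pos (Real.cosh_pos _)]
  nlinarith [abs_nonneg (Real.sin z.re)]

theorem sinh_abs_im_le_norm_sin (z : ℂ) : Real.sinh |z.im| ≤ ‖Complex.sin z‖ := by
  have h1 : (Complex.sin z).re = Real.sin z.re * Real.cosh z.im := by
    rw [Complex.sin_eq]
    simp [← Complex.ofReal_sin, ← Complex.ofReal_cos, ← Complex.ofReal_cosh, ← Complex.ofReal_sinh]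
  have h2 : (Complex.sin z).im = Real.cos z.re * Real.sinh z.im := by
    rw [Complex.sin_eq]
    simp [← Complex.ofReal_sin, ← Complex.ofReal_cos, ← Complex.ofReal_cosh, ← Complex.ofReal_sinh]
  refine le_of_sq_le_sq ?_ (norm_nonneg _)
  rw [← Complex.normSq_eq_norm_sq, Complex.normSq_apply, h1, h2, ← Real.abs_sinh, sq_abs]
  have h3 := Real.sin_sq_add_cos_sq z.re
  have h4 := Real.cosh_sq z.im
  have e : Real.sin z.re * Real.cosh z.im * (Real.sin z.re * Real.cosh z.im) +
      Real.cos z.re * Real.sinh z.im * (Real.cos z.re * Real.sinh z.im) =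
      (Real.sin z.re ^ 2 + Real.cos z.re ^ 2) * Real.sinh z.im ^ 2 + Real.sin z.re ^ 2 := by
    linear_combination Real.sin z.re ^ 2 * h4
  rw [e, h3, one_mul]
  nlinarith [sq_nonneg (Real.sin z.re)]

/-- On `D` the function `sin (π (β - s))` has the largest growth possible. -/
def SinLowerBound (D : Set ℂ) (β : ℂ) : Prop :=
  ∃ c : ℝ, 0 < c ∧
    ∀ s ∈ D, c * Real.exp (Real.pi * |s.im|) ≤ ‖Complex.sin (Real.pi * (β - s))‖

theorem exp_pi_abs_im_le (β s : ℂ) : Real.exp (-(Real.pi * |β.im|)) * Real.exp (Real.pi * |s.im|) ≤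
    Real.exp |(Real.pi * (β - s)).im| := by
  rw [← Real.exp_add, Real.exp_le_exp]
  have : |(Real.pi * (β - s)).im| = Real.pi * |β.im - s.im| := by
    simp [abs_mul, abs_of_pos Real.pi_pos]
  have h2 := abs_sub_abs_le_abs_sub s.im β.im
  rw [abs_sub_comm] at h2
  rw [this]
  nlinarith [Real.pi_pos]

/-- Moving `s` by an integer changes only the sign of the sine, so one line free of zeros gives a
bound uniform over all its integer translates. -/
theorem sinLowerBound_of_re {D : Set ℂ} {β : ℂ} {x : ℝ} (hx : ∀ j : ℤ, β.re - x ≠ j)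
    (hD : ∀ s ∈ D, ∃ N : ℕ, s.re = x + N) : SinLowerBound D β := by
  have h0 : Real.sin (Real.pi * (β.re - x)) ≠ 0 := by
    intro h
    obtain ⟨j, hj⟩ := Real.sin_eq_zero_iff.1 h
    refine hx j ?_
    have := Real.pi_pos.ne'
    exact (mul_left_cancel₀ this (by rw [← hj]; ring))
  refine ⟨|Real.sin (Real.pi * (β.re - x))| / 2 * Real.exp (-(Real.pi * |β.im|)),
    by positivity, fun s hs => ?_⟩
  obtain ⟨N, hN⟩ := hD s hs
  refine le_trans ?_ (abs_sin_re_mul_exp_le_norm_sin _)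
  have e : (Real.pi * (β - s) : ℂ).re = Real.pi * (β.re - x) - N * Real.pi := by
    simp [hN]; ring
  rw [e, Real.sin_sub_nat_mul_pi, abs_mul, abs_pow, abs_neg, abs_one, one_pow, one_mul, mul_assoc]
  exact mul_le_mul_of_nonneg_left (exp_pi_abs_im_le β s) (by positivity)

/-- Uses `|sin z| ≥ sinh |im z|`, where `sinh y = exp y (1 - exp(-2y)) / 2` and the bracket stays
positive for `y ≥ πη`. -/
theorem sinLowerBound_of_im {D : Set ℂ} {β : ℂ} {η : ℝ} (hη : 0 < η)
    (hD : ∀ s ∈ D, η ≤ |β.im - s.im|) : SinLowerBound D β := by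
  have hpi := Real.pi_pos
  have hlt : Real.exp (-(2 * (Real.pi * η))) < 1 :=
    Real.exp_lt_one_iff.2 (by nlinarith)
  refine ⟨(1 - Real.exp (-(2 * (Real.pi * η)))) / 2 * Real.exp (-(Real.pi * |β.im|)),
    mul_pos (by linarith) (Real.exp_pos _), fun s hs => ?_⟩
  refine le_trans ?_ (sinh_abs_im_le_norm_sin _)
  rw [mul_assoc]
  refine (mul_le_mul_of_nonneg_left (exp_pi_abs_im_le β s) (by linarith)).trans ?_
  set y := |(Real.pi * (β - s)).im| with hy
  have hy2 : Real.pi * η ≤ y := by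
    have : y = Real.pi * |β.im - s.im| := by
      simp [hy, abs_mul, abs_of_pos Real.pi_pos]
    rw [this]
    exact mul_le_mul_of_nonneg_left (hD s hs) hpi.le
  have h1 : Real.exp (-y) = Real.exp y * Real.exp (-(2 * y)) := by
    rw [← Real.exp_add]; ring_nf
  have h2 : Real.exp (-(2 * y)) ≤ Real.exp (-(2 * (Real.pi * η))) :=
    Real.exp_le_exp.2 (by linarith)
  rw [Real.sinh_eq, h1]
  nlinarith [Real.exp_pos y]

theorem expPolyBound_pi_div_sin {D : Set ℂ} {β : ℂ} (h : SinLowerBound D β) :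
    ExpPolyBound D (fun s => Real.pi / Complex.sin (Real.pi * (β - s))) 0 (-Real.pi) := by
  obtain ⟨c, hc, hD⟩ := h
  refine ExpPolyBound.of_norm_le_exp (C := Real.pi / c) (by positivity) fun s hs => ?_
  rw [norm_div, Complex.norm_real, Real.norm_of_nonneg Real.pi_pos.le]
  calc Real.pi / ‖Complex.sin (Real.pi * (β - s))‖ ≤
        Real.pi / (c * Real.exp (Real.pi * |s.im|)) :=
        div_le_div_of_nonneg_left Real.pi_pos.le (by positivity) (hD s hs)
    _ = _ := by
      rw [zero_mul, zero_add, neg_mul, Real.exp_neg]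
      field_simp

theorem Gamma_eq_pi_div_sin_mul_inv_Gamma {z : ℂ} (hz : Complex.sin (Real.pi * z) ≠ 0) :
    Complex.Gamma z = Real.pi / Complex.sin (Real.pi * z) * (Complex.Gamma (1 - z))⁻¹ := by
  have h := Complex.Gamma_mul_Gamma_one_sub z
  have hne : Complex.Gamma (1 - z) ≠ 0 := by
    intro h0
    rw [h0, mul_zero] at h
    exact div_ne_zero (by simp) hz h.symm
  rw [← h, mul_inv_cancel_right₀ hne]

theorem inv_Gamma_eq_sin_div_pi_mul_Gamma {z : ℂ} (hz : ∀ r : ℕ, 1 - z ≠ -r) :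
    (Complex.Gamma z)⁻¹ = Complex.sin (Real.pi * z) * (Real.pi : ℂ)⁻¹ * Complex.Gamma (1 - z) := by
  have hpi : (Real.pi : ℂ) ≠ 0 := by simp
  have h := Complex.Gamma_mul_Gamma_one_sub z
  have hne : Complex.Gamma (1 - z) ≠ 0 := Complex.Gamma_ne_zero hz
  -- Where the sine vanishes, the reflection formula reads `Γ(z) Γ(1 - z) = π / 0 = 0`. As `Γ(1 - z)
  -- ≠ 0`, the default value `Γ(z) = 0` results, and both sides are 0.
  by_cases hs : Complex.sin (Real.pi * z) = 0
  · rw [hs, div_zero] at h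
    simp [(mul_eq_zero.1 h).resolve_right hne, hs]
  · have hne' : Complex.Gamma z ≠ 0 := by
      intro h0
      rw [h0, zero_mul] at h
      exact div_ne_zero hpi hs h.symm
    rw [eq_div_iff hs] at h
    generalize Complex.sin (Real.pi * z) = S at *
    rw [inv_eq_iff_eq_inv, mul_inv, mul_inv, inv_inv, ← h]
    field_simp

/-- After the reflection formula every upper parameter gives `Γ(s + 1 - a_l)` in the numerator and
every lower one `Γ(s + 1 - b_l)` in the denominator. `P` quotients are paired and grow polynomially;
the `Q - P` unpaired reciprocals decay faster than any `exp(-K re s)` at the price `π/2` each in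
`|im s|`. The `M` sines below contribute `-π` each and the `P - N` sines above `π` each, whence the
exponent in `|im s|`. The number `K` is free, so that a negative first exponent can be arranged
later. -/
theorem expPolyBound_integrand {M N P Q : ℕ} (hPQ : P ≤ Q) (hM : M ≤ Q) (hN : N ≤ P)
    (a : Fin P → ℂ) (b : Fin Q → ℂ) (ω : ℂ) {D : Set ℂ} {B : ℝ} (hB : ∀ s ∈ D, -B ≤ s.re)
    (ha : ∀ s ∈ D, ∀ l, 1 ≤ (s + (1 - a l)).re ∨ 1 ≤ |(s + (1 - a l)).im|)
    (hb : ∀ l : Fin Q, l.val < M → SinLowerBound D (b l)) (K : ℝ) :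
    ExpPolyBound D (integrand M N a b ω) (ω.re - ((Q : ℝ) - P) * K)
      (|ω.im| - ((M : ℝ) + N - ((P : ℝ) + Q) / 2) * Real.pi) := by
  obtain ⟨d, rfl⟩ := Nat.exists_eq_add_of_le hPQ
  have H0 := expPolyBound_exp D ω
  have H1 := ExpPolyBound.prod (D := D) (u := 0) (v := -Real.pi) {l : Fin (P + d) | l.val < M}
    (f := fun l s => Real.pi / Complex.sin (Real.pi * (b l - s)))
    (fun l hl => expPolyBound_pi_div_sin (hb l (by simpa using hl)))
  have H2 := ExpPolyBound.prod (D := D) (u := 0) (v := Real.pi) {l : Fin P | N ≤ l.val}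
    (f := fun l s => Complex.sin (Real.pi * (a l - s)) * (Real.pi : ℂ)⁻¹)
    (fun l hl => by
      simpa using (expPolyBound_sin D (a l)).mul (ExpPolyBound.const (Real.pi : ℂ)⁻¹))
  have H3 := ExpPolyBound.prod (D := D) (u := 0) (v := 0) (Finset.univ : Finset (Fin P))
    (f := fun l s => Complex.Gamma (s + (1 - a l)) *
      (Complex.Gamma (s + (1 - b (Fin.castAdd d l))))⁻¹)
    (fun l _ => expPolyBound_Gamma_div_Gamma hB _ _ (fun s hs => ha s hs l))
  have H4 := ExpPolyBound.prod (D := D) (u := -K) (v := Real.pi / 2)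
    (Finset.univ : Finset (Fin d))
    (f := fun l s => (Complex.Gamma (s + (1 - b (Fin.natAdd P l))))⁻¹)
    (fun l _ => expPolyBound_inv_Gamma hB _ K)
  have H := (((H0.mul H1).mul H2).mul H3).mul H4
  have c1 : Finset.card {l : Fin (P + d) | l.val < M} = M := by
    rw [Fin.card_filter_val_lt, min_eq_right hM]
  have c2 : Finset.card {l : Fin P | N ≤ l.val} = P - N := by
    have h := Finset.card_filter_add_card_filter_not (s := Finset.univ)
      (fun l : Fin P => l.val < N)
    rw [Fin.card_filter_val_lt, min_eq_right hN, Finset.card_univ, Fintype.card_fin] at h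
    simp only [not_lt] at h
    omega
  rw [c1, c2, Nat.cast_sub hN, Finset.card_univ, Finset.card_univ, Fintype.card_fin,
    Fintype.card_fin] at H
  have eu : ω.re + M * 0 + ((P : ℝ) - N) * 0 + P * 0 + d * -K =
      ω.re - (((P + d : ℕ) : ℝ) - P) * K := by push_cast; ring
  have ev : |ω.im| + M * -Real.pi + ((P : ℝ) - N) * Real.pi + P * 0 + d * (Real.pi / 2) =
      |ω.im| - ((M : ℝ) + N - ((P : ℝ) + (P + d : ℕ)) / 2) * Real.pi := by push_cast; ring
  rw [eu, ev] at H
  refine H.of_norm_le fun s hs => le_of_eq ?_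
  congr 1
  have hne : ∀ l, ∀ r : ℕ, 1 - (a l - s) ≠ -r := by
    intro l r h
    have e : s + (1 - a l) = -r := by rw [← h]; ring
    rcases ha s hs l with h1 | h1
    · rw [e] at h1; simp at h1; linarith [(Nat.cast_nonneg r : (0 : ℝ) ≤ r)]
    · rw [e] at h1; simp at h1; linarith
  have hsin : ∀ l : Fin (P + d), l.val < M → Complex.sin (Real.pi * (b l - s)) ≠ 0 := by
    intro l hl h0
    obtain ⟨c, hc, h⟩ := hb l hl
    have := h s hs
    rw [h0, norm_zero] at this
    exact absurd this (not_le.2 (by positivity))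
  have E1 : ∏ l : Fin (P + d) with l.val < M, Complex.Gamma (b l - s) =
      (∏ l : Fin (P + d) with l.val < M, Real.pi / Complex.sin (Real.pi * (b l - s))) *
      ∏ l : Fin (P + d) with l.val < M, (Complex.Gamma (s + (1 - b l)))⁻¹ := by
    rw [← Finset.prod_mul_distrib]
    refine Finset.prod_congr rfl fun l hl => ?_
    rw [Gamma_eq_pi_div_sin_mul_inv_Gamma (hsin l (by simpa using hl))]
    ring_nf
  have E2 : (∏ l : Fin P with N ≤ l.val, Complex.Gamma (a l - s))⁻¹ =
      (∏ l : Fin P with N ≤ l.val, Complex.sin (Real.pi * (a l - s)) * (Real.pi : ℂ)⁻¹) *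
      ∏ l : Fin P with N ≤ l.val, Complex.Gamma (s + (1 - a l)) := by
    rw [← Finset.prod_inv_distrib, ← Finset.prod_mul_distrib]
    refine Finset.prod_congr rfl fun l _ => ?_
    rw [inv_Gamma_eq_sin_div_pi_mul_Gamma (hne l)]
    ring_nf
  have E3 : ∏ l : Fin P, Complex.Gamma (s + (1 - a l)) =
      (∏ l : Fin P with l.val < N, Complex.Gamma (1 - a l + s)) *
      ∏ l : Fin P with N ≤ l.val, Complex.Gamma (s + (1 - a l)) := by
    rw [← Finset.prod_filter_mul_prod_filter_not Finset.univ (fun l : Fin P => l.val < N)]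
    simp only [not_lt, add_comm s]
  have E4 : ∏ l : Fin (P + d), (Complex.Gamma (s + (1 - b l)))⁻¹ =
      (∏ l : Fin (P + d) with l.val < M, (Complex.Gamma (s + (1 - b l)))⁻¹) *
      (∏ l : Fin (P + d) with M ≤ l.val, Complex.Gamma (1 - b l + s))⁻¹ := by
    rw [← Finset.prod_filter_mul_prod_filter_not Finset.univ (fun l : Fin (P + d) => l.val < M),
      ← Finset.prod_inv_distrib]
    simp only [not_lt, add_comm s]
  rw [Fin.prod_univ_add] at E4
  rw [integrand, div_eq_mul_inv, mul_inv, E2, E1, Finset.prod_mul_distrib (s := Finset.univ), E3]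
  linear_combination (Complex.exp (s * ω) *
    (∏ l : Fin (P + d) with l.val < M, Real.pi / Complex.sin (Real.pi * (b l - s))) *
    (∏ l : Fin P with N ≤ l.val, Complex.sin (Real.pi * (a l - s)) * (Real.pi : ℂ)⁻¹) *
    (∏ l : Fin P with l.val < N, Complex.Gamma (1 - a l + s)) *
      ∏ l : Fin P with N ≤ l.val, Complex.Gamma (s + (1 - a l))) * (-E4)

end MeijerG
end

/-! ### Principal parts, primitives up to simple fractions, and curve integrals. -/

noncomputable section
namespace MeijerG

open MeasureTheory Set Filter

/-- Each step splits off the value: `h(s) = h(w) + (s - w) dslope h w s`. The term `h(w) / (s -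
w)^(n+1)` joins the residue if `n = 0` and has an explicit primitive otherwise. -/
theorem exists_principal_part_of_analyticAt_div {w : ℂ} (n : ℕ) :
    ∀ h : ℂ → ℂ, AnalyticAt ℂ h w → ∃ (r : ℂ) (q Q g : ℂ → ℂ),
      (∀ s, s ≠ w → HasDerivAt Q (q s) s) ∧ DifferentiableOn ℂ q {w}ᶜ ∧ AnalyticAt ℂ g w ∧
      ∀ s, s ≠ w → h s / (s - w) ^ n = r / (s - w) + q s + g s := by
  induction n with
  | zero =>
    intro h hh
    exact ⟨0, 0, 0, h, fun s _ => hasDerivAt_const s 0, differentiableOn_const 0, hh,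
      fun s _ => by simp⟩
  | succ n ih =>
    intro h hh
    have hd : AnalyticAt ℂ (dslope h w) w := by
      obtain ⟨p, hp⟩ := hh
      exact ⟨_, hp.has_fpower_series_dslope_fslope⟩
    obtain ⟨r, q, Q, g, hQ, hq, hg, he⟩ := ih _ hd
    have hs : ∀ s, s ≠ w → h s / (s - w) ^ (n + 1) =
        h w / (s - w) ^ (n + 1) + (r / (s - w) + q s + g s) := by
      intro s hs
      have h0 : s - w ≠ 0 := sub_ne_zero.2 hs
      rw [← he s hs, dslope_of_ne _ hs, slope_def_field]
      field_simp
      ring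
    rcases Nat.eq_zero_or_pos n with rfl | hn
    · refine ⟨h w + r, q, Q, g, hQ, hq, hg, fun s hsw => ?_⟩
      rw [hs s hsw]
      ring
    · refine ⟨r, fun s => h w / (s - w) ^ (n + 1) + q s,
        fun s => -(h w / n) * ((s - w) ^ n)⁻¹ + Q s, g, fun s hsw => ?_, ?_, hg, fun s hsw => ?_⟩
      · refine HasDerivAt.add ?_ (hQ s hsw)
        have h0 : s - w ≠ 0 := sub_ne_zero.2 hsw
        have hn' : (n : ℂ) ≠ 0 := by exact_mod_cast hn.ne'
        have h1 := ((((hasDerivAt_id s).sub_const w).pow n).inv (pow_ne_zero n h0)).const_mul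
          (-(h w / n))
        refine h1.congr_deriv ?_
        obtain ⟨j, rfl⟩ := Nat.exists_eq_succ_of_ne_zero hn.ne'
        simp only [id, Nat.succ_eq_add_one, Nat.add_sub_cancel, Pi.pow_apply]
        field_simp
        ring
      · refine DifferentiableOn.add ?_ hq
        intro s hsw
        have h0 : s - w ≠ 0 := sub_ne_zero.2 hsw
        refine DifferentiableAt.differentiableWithinAt ?_
        exact (differentiableAt_const _).div (by fun_prop) (pow_ne_zero _ h0)
      · rw [hs s hsw]; ring

theorem exists_principal_part {F : ℂ → ℂ} {w : ℂ} (hF : MeromorphicAt F w) :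
    ∃ (r : ℂ) (q Q g : ℂ → ℂ),
      (∀ s, s ≠ w → HasDerivAt Q (q s) s) ∧ DifferentiableOn ℂ q {w}ᶜ ∧ AnalyticAt ℂ g w ∧
      ∀ s, s ≠ w → F s = r / (s - w) + q s + g s := by
  obtain ⟨n, hn⟩ := hF
  obtain ⟨r, q, Q, g, hQ, hq, hg, he⟩ := exists_principal_part_of_analyticAt_div n _ hn
  refine ⟨r, q, Q, g, hQ, hq, hg, fun s hs => ?_⟩
  rw [← he s hs, smul_eq_mul, mul_div_cancel_left₀ _ (pow_ne_zero n (sub_ne_zero.2 hs))]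

/-- On a convex open set, a function with finitely many poles has a primitive up to simple
fractions. -/
theorem exists_residues_primitive {U : Set ℂ} (hU : IsOpen U) (hc : Convex ℝ U) (S : Finset ℂ) :
    ∀ F : ℂ → ℂ, DifferentiableOn ℂ F (U \ S) → (∀ w ∈ S, MeromorphicAt F w) →
      ∃ ρ G : ℂ → ℂ, ∀ s ∈ U \ S, HasDerivAt G (F s - ∑ w ∈ S, ρ w / (s - w)) s := by
  classical
  induction S using Finset.induction_on with
  | empty =>
    intro F hF _
    obtain ⟨G, hG⟩ := hc.exists_forall_hasDerivWithinAt (by simpa using hF)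
    exact ⟨0, G, fun s hs => by
      simpa using (hG s hs.1).hasDerivAt (hU.mem_nhds hs.1)⟩
  | insert w S hw ih =>
    intro F hF hm
    obtain ⟨r, q, Q, g, hQ, hq, hg, he⟩ :=
      exists_principal_part (hm w (Finset.mem_insert_self w S))
    -- Remove the principal part at `w` and fill in the value `g w`. The result is differentiable at
    -- `w`, so the induction hypothesis for the smaller set applies.
    set F' : ℂ → ℂ := fun s => F s - r / (s - w) - q s with hF'
    set F₁ : ℂ → ℂ := Function.update F' w (g w) with hF₁
    have hne : ∀ s, s ≠ w → F₁ =ᶠ[𝓝 s] F' := fun s hs => by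
      filter_upwards [isOpen_ne.mem_nhds hs] with t ht
      exact Function.update_of_ne ht _ _
    have hself : F₁ =ᶠ[𝓝 w] g := by
      refine Eventually.of_forall fun s => ?_
      rcases eq_or_ne s w with rfl | hs
      · simp [hF₁]
      · rw [hF₁, Function.update_of_ne hs, hF']
        simp only [he s hs]; ring
    have hfrac : ∀ s, s ≠ w → DifferentiableAt ℂ (fun s => r / (s - w)) s := fun s hs =>
      (differentiableAt_const _).div (by fun_prop) (sub_ne_zero.2 hs)
    have hq' : ∀ s, s ≠ w → AnalyticAt ℂ q s := fun s hs =>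
      hq.analyticAt (isOpen_compl_singleton.mem_nhds hs)
    have hd : DifferentiableOn ℂ F₁ (U \ S) := by
      intro s hs
      refine DifferentiableAt.differentiableWithinAt ?_
      rcases eq_or_ne s w with rfl | hsw
      · exact (hself.differentiableAt_iff).2 hg.differentiableAt
      · refine ((hne s hsw).differentiableAt_iff).2 ?_
        have hopen : IsOpen (U \ ((insert w S : Finset ℂ) : Set ℂ)) :=
          hU.sdiff (Finset.finite_toSet _).isClosed
        have hmem : s ∈ U \ ((insert w S : Finset ℂ) : Set ℂ) := by
          refine ⟨hs.1, ?_⟩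
          simpa [hsw] using hs.2
        exact ((hF.differentiableAt (hopen.mem_nhds hmem)).sub (hfrac s hsw)).sub
          (hq' s hsw).differentiableAt
    have hm' : ∀ v ∈ S, MeromorphicAt F₁ v := by
      intro v hv
      have hvw : v ≠ w := fun h => hw (h ▸ hv)
      refine MeromorphicAt.congr ?_ ((hne v hvw).symm.filter_mono nhdsWithin_le_nhds)
      refine ((hm v (Finset.mem_insert_of_mem hv)).sub ?_).sub (hq' v hvw).meromorphicAt
      exact (MeromorphicAt.const r v).div ((MeromorphicAt.id v).sub (MeromorphicAt.const w v))
    obtain ⟨ρ, G, hG⟩ := ih F₁ hd hm'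
    refine ⟨Function.update ρ w r, fun s => G s + Q s, fun s hs => ?_⟩
    have hsw : s ≠ w := fun h => hs.2 (by simp [h])
    have hsS : s ∈ U \ (S : Set ℂ) := ⟨hs.1, fun h => hs.2 (by simp [Finset.mem_coe.1 h])⟩
    refine ((hG s hsS).add (hQ s hsw)).congr_deriv ?_
    have hsum : ∑ v ∈ S, Function.update ρ w r v / (s - v) = ∑ v ∈ S, ρ v / (s - v) :=
      Finset.sum_congr rfl fun v hv => by
        rw [Function.update_of_ne (ne_of_mem_of_not_mem hv hw)]
    rw [Finset.sum_insert hw, hsum, Function.update_self, (hne s hsw).self_of_nhds, hF']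
    ring

/-- A local Lipschitz constant bounds `deriv γ` everywhere, including its default value at corners.
-/
theorem locallyIntegrable_deriv {γ : ℝ → ℂ} (hγ : LocallyLipschitz γ) :
    LocallyIntegrable (deriv γ) := by
  intro x
  obtain ⟨K, t, ht, hK⟩ := hγ x
  refine ⟨interior t ∩ Ioo (x - 1) (x + 1), inter_mem (interior_mem_nhds.2 ht)
    (Ioo_mem_nhds (by linarith) (by linarith)), ?_⟩
  refine Measure.integrableOn_of_bounded (M := K) ?_ (measurable_deriv γ).aestronglyMeasurable ?_
  · exact ((measure_mono inter_subset_right).trans_lt (by simp)).ne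
  · filter_upwards [ae_restrict_mem (isOpen_interior.measurableSet.inter measurableSet_Ioo)] with y hy
    exact norm_deriv_le_of_lipschitzOn (mem_interior_iff_mem_nhds.1 hy.1) hK

theorem locallyIntegrable_mul_deriv {γ f : ℝ → ℂ} (hγ : LocallyLipschitz γ) (hf : Continuous f) :
    LocallyIntegrable (fun t => f t * deriv γ t) := by
  have := ((locallyIntegrable_deriv hγ).locallyIntegrableOn univ).continuousOn_mul
    hf.continuousOn isOpen_univ.isLocallyClosed
  exact locallyIntegrableOn_univ.1 this

theorem intervalIntegrable_mul_deriv {γ f : ℝ → ℂ} (hγ : LocallyLipschitz γ) {a b : ℝ}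
    (hf : ContinuousOn f (uIcc a b)) :
    IntervalIntegrable (fun t => f t * deriv γ t) volume a b := by
  have h : IntervalIntegrable (deriv γ) volume a b :=
    ((locallyIntegrable_deriv hγ).integrableOn_isCompact isCompact_uIcc).intervalIntegrable
  exact h.continuousOn_mul hf

theorem integral_mul_deriv_eq_sub {γ : ℝ → ℂ} (hγ : IsPiecewiseC1 γ) {f G : ℂ → ℂ} {a b : ℝ}
    (hf : ContinuousOn (fun t => f (γ t)) (uIcc a b))
    (hG : ∀ t ∈ uIcc a b, HasDerivAt G (f (γ t)) (γ t)) :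
    ∫ t in a..b, f (γ t) * deriv γ t = G (γ b) - G (γ a) := by
  obtain ⟨hlip, S, hS, hd⟩ := hγ
  refine integral_eq_of_hasDerivAt_off_countable (fun t => G (γ t)) _ hS.countable ?_ ?_
    (intervalIntegrable_mul_deriv hlip hf)
  · intro t ht
    exact ((hG t ht).continuousAt.comp hlip.continuous.continuousAt).continuousWithinAt
  · intro t ht
    have h1 : t ∈ uIcc a b := Ioo_subset_Icc_self ht.1
    have h2 : HasDerivAt γ (deriv γ t) t :=
      ((hd t ht.2).differentiableAt one_ne_zero).hasDerivAt
    exact (hG t h1).comp t h2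

/-- The real part of the logarithm is single-valued, so no branch has to be followed along the
curve. -/
theorem re_integral_deriv_div_sub {γ : ℝ → ℂ} (hγ : IsPiecewiseC1 γ) {w : ℂ}
    (hw : ∀ t, γ t ≠ w) (a b : ℝ) :
    (∫ t in a..b, deriv γ t / (γ t - w)).re = Real.log ‖γ b - w‖ - Real.log ‖γ a - w‖ := by
  obtain ⟨hlip, S, hS, hd⟩ := hγ
  have hne : ∀ t, γ t - w ≠ 0 := fun t => sub_ne_zero.2 (hw t)
  have hcont : Continuous fun t => (γ t - w)⁻¹ := (hlip.continuous.sub continuous_const).inv₀ hne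
  have hint : IntervalIntegrable (fun t => deriv γ t / (γ t - w)) volume a b := by
    simpa only [div_eq_inv_mul] using intervalIntegrable_mul_deriv hlip hcont.continuousOn
  have hre : (∫ t in a..b, deriv γ t / (γ t - w)).re =
      ∫ t in a..b, (deriv γ t / (γ t - w)).re :=
    (Complex.reCLM.intervalIntegral_comp_comm hint).symm
  rw [hre]
  refine integral_eq_of_hasDerivAt_off_countable (fun t => Real.log ‖γ t - w‖) _ hS.countable
    ?_ ?_ ((intervalIntegrable_iff).2 (Complex.reCLM.integrable_comp hint.def'))
  · exact ((hlip.continuous.sub continuous_const).norm.log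
      fun t => norm_ne_zero_iff.2 (hne t)).continuousOn
  · intro t ht
    have h2 : HasDerivAt γ (deriv γ t) t :=
      ((hd t ht.2).differentiableAt one_ne_zero).hasDerivAt
    -- Dividing by the value at `t` brings the argument to 1 there, inside the slit plane.
    have h3 : HasDerivAt (fun x => Complex.log ((γ x - w) / (γ t - w)))
        (deriv γ t / (γ t - w)) t := by
      have h4 := ((h2.sub_const w).div_const (γ t - w)).clog_real (by simp [hne t])
      refine h4.congr_deriv ?_
      rw [div_self (hne t), div_one]
    have h5 : HasDerivAt (fun x => (Complex.log ((γ x - w) / (γ t - w))).re)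
        (deriv γ t / (γ t - w)).re t := by
      exact Complex.reCLM.hasFDerivAt.comp_hasDerivAt t h3
    have h6 := h5.add_const (Real.log ‖γ t - w‖)
    refine h6.congr_of_eventuallyEq (Eventually.of_forall fun x => ?_)
    simp only [Complex.log_re, norm_div]
    rw [Real.log_div (norm_ne_zero_iff.2 (hne x)) (norm_ne_zero_iff.2 (hne t))]
    ring

end MeijerG
end

/-! ### Change of argument compared with principal logarithms. -/

noncomputable section
namespace MeijerG

open MeasureTheory Set Filter

/-- The integral of `1 / (s - w)` along the part `|t| ≤ R` of `γ`, completed to a closed curve in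
the plane slit to the left of `w`. -/
def logDefect (γ : ℝ → ℂ) (w : ℂ) (R : ℝ) : ℂ :=
  (∫ t in (-R)..R, deriv γ t / (γ t - w)) + Complex.log (γ (-R) - w) - Complex.log (γ R - w)

theorem tendsto_arg_add_mul {ζ : ℂ} (hζ : ζ ∈ Complex.slitPlane) (z : ℂ) :
    Tendsto (fun t : ℝ => Complex.arg (z + t * ζ)) atTop (𝓝 (Complex.arg ζ)) := by
  have h1 : Tendsto (fun t : ℝ => ((t⁻¹ : ℝ) : ℂ) * z + ζ) atTop (𝓝 ζ) := by
    have : Tendsto (fun t : ℝ => ((t⁻¹ : ℝ) : ℂ)) atTop (𝓝 ((0 : ℝ) : ℂ)) :=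
      (Complex.continuous_ofReal.tendsto 0).comp tendsto_inv_atTop_zero
    simpa using (this.mul_const z).add_const ζ
  refine ((Complex.continuousAt_arg hζ).tendsto.comp h1).congr' ?_
  filter_upwards [eventually_gt_atTop 0] with t ht
  have h0 : (t : ℂ) ≠ 0 := by exact_mod_cast ht.ne'
  rw [Function.comp_apply, ← Complex.arg_real_mul (z + t * ζ) (inv_pos.2 ht)]
  congr 1
  push_cast
  field_simp

theorem integral_deriv_div_sub_eq_log_sub_log {γ : ℝ → ℂ} (hγ : IsPiecewiseC1 γ) {w : ℂ} {a b : ℝ}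
    (h : ∀ t ∈ uIcc a b, γ t - w ∈ Complex.slitPlane) :
    ∫ t in a..b, deriv γ t / (γ t - w) = Complex.log (γ b - w) - Complex.log (γ a - w) := by
  have hne : ∀ t ∈ uIcc a b, γ t - w ≠ 0 := fun t ht => Complex.slitPlane_ne_zero (h t ht)
  have := integral_mul_deriv_eq_sub hγ (f := fun z => (z - w)⁻¹)
    (G := fun z => Complex.log (z - w)) (a := a) (b := b)
    ((hγ.1.continuous.sub continuous_const).continuousOn.inv₀ hne)
    (fun t ht => by
      have h1 := ((hasDerivAt_id (γ t)).sub_const w).clog (h t ht)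
      simpa using h1)
  simpa only [div_eq_inv_mul] using this

theorem intervalIntegrable_deriv_div_sub {γ : ℝ → ℂ} (hγ : IsPiecewiseC1 γ) {w : ℂ}
    (hw : ∀ t, γ t ≠ w) (a b : ℝ) :
    IntervalIntegrable (fun t => deriv γ t / (γ t - w)) volume a b := by
  have hcont : Continuous fun t => (γ t - w)⁻¹ :=
    (hγ.1.continuous.sub continuous_const).inv₀ fun t => sub_ne_zero.2 (hw t)
  simpa only [div_eq_inv_mul] using intervalIntegrable_mul_deriv hγ.1 hcont.continuousOn

/-- Beyond `R` both ends of the curve stay in the slit plane at `w`, where the principal logarithm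
is a primitive; lengthening the curve there changes nothing. -/
theorem logDefect_eq_logDefect {γ : ℝ → ℂ} (hγ : IsPiecewiseC1 γ) {w : ℂ} (hw : ∀ t, γ t ≠ w)
    {R R' : ℝ} (hR : R ≤ R') (h₁ : ∀ t ≤ -R, γ t - w ∈ Complex.slitPlane)
    (h₂ : ∀ t, R ≤ t → γ t - w ∈ Complex.slitPlane) :
    logDefect γ w R' = logDefect γ w R := by
  have hi := intervalIntegrable_deriv_div_sub hγ hw
  have e1 := integral_deriv_div_sub_eq_log_sub_log hγ (w := w) (a := -R') (b := -R)
    (fun t ht => h₁ t (by rw [uIcc_of_le (by linarith)] at ht; exact ht.2))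
  have e2 := integral_deriv_div_sub_eq_log_sub_log hγ (w := w) (a := R) (b := R')
    (fun t ht => h₂ t (by rw [uIcc_of_le (by linarith)] at ht; exact ht.1))
  have e3 := intervalIntegral.integral_add_adjacent_intervals (hi (-R') (-R)) (hi (-R) R)
  have e4 := intervalIntegral.integral_add_adjacent_intervals (hi (-R') R) (hi R R')
  rw [logDefect, logDefect, ← e4, ← e3, e1, e2]
  ring

/-- `ArgChange` only prescribes a limit. Since the defect is constant from `R` on, its value at the
finite `R` equals that limit, with the asymptotic directions of the two ends entering through their
arguments. The real part cancels. -/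
theorem logDefect_eq {γ : ℝ → ℂ} (hγ : IsPiecewiseC1 γ) {w : ℂ} {θ : ℝ} (hθ : ArgChange γ w θ)
    {T : ℝ} {z₁ z₂ ζ₁ ζ₂ : ℂ} (hζ₁ : ζ₁ ∈ Complex.slitPlane) (hζ₂ : ζ₂ ∈ Complex.slitPlane)
    (ht₁ : ∀ t, T ≤ t → γ (-t) = z₁ + t * ζ₁) (ht₂ : ∀ t, T ≤ t → γ t = z₂ + t * ζ₂)
    {R : ℝ} (h₁ : ∀ t ≤ -R, γ t - w ∈ Complex.slitPlane)
    (h₂ : ∀ t, R ≤ t → γ t - w ∈ Complex.slitPlane) :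
    logDefect γ w R = Complex.I * (θ + Complex.arg ζ₁ - Complex.arg ζ₂ : ℝ) := by
  obtain ⟨hw, hlim⟩ := hθ
  apply Complex.ext
  · rw [logDefect, Complex.sub_re, Complex.add_re, re_integral_deriv_div_sub hγ hw,
      Complex.log_re, Complex.log_re]
    simp
  · have a1 : Tendsto (fun t : ℝ => Complex.arg (γ (-t) - w)) atTop (𝓝 (Complex.arg ζ₁)) := by
      refine (tendsto_arg_add_mul hζ₁ (z₁ - w)).congr' ?_
      filter_upwards [eventually_ge_atTop T] with t ht
      rw [ht₁ t ht]; ring_nf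
    have a2 : Tendsto (fun t : ℝ => Complex.arg (γ t - w)) atTop (𝓝 (Complex.arg ζ₂)) := by
      refine (tendsto_arg_add_mul hζ₂ (z₂ - w)).congr' ?_
      filter_upwards [eventually_ge_atTop T] with t ht
      rw [ht₂ t ht]; ring_nf
    have hL : Tendsto (fun t : ℝ => (logDefect γ w t).im) atTop
        (𝓝 (θ + Complex.arg ζ₁ - Complex.arg ζ₂)) := by
      simpa only [logDefect, Complex.sub_im, Complex.add_im, Complex.log_im] using
        (hlim.add a1).sub a2
    have hc : Tendsto (fun t : ℝ => (logDefect γ w t).im) atTop (𝓝 (logDefect γ w R).im) := by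
      refine tendsto_const_nhds.congr' ?_
      filter_upwards [eventually_ge_atTop R] with t ht
      rw [logDefect_eq_logDefect hγ hw ht h₁ h₂]
    rw [tendsto_nhds_unique hc hL]
    simp

end MeijerG
end

/-! ### Residue sums for truncated and closed paths. -/

noncomputable section
namespace MeijerG

open MeasureTheory Set Filter

/-- On `U`, the function `g` is the derivative of `G` plus the simple fractions `ρ w / (s - w)`,
`w ∈ W`. -/
structure HasResidues (g : ℂ → ℂ) (U : Set ℂ) (W : Finset ℂ) (ρ G : ℂ → ℂ) : Prop where
  continuousOn : ContinuousOn g (U \ W)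
  hasDerivAt : ∀ s ∈ U \ W, HasDerivAt G (g s - ∑ w ∈ W, ρ w / (s - w)) s

/-- The primitive of `g` obtained from the principal branches of the logarithms. -/
def slitPrimitive (W : Finset ℂ) (ρ G : ℂ → ℂ) (s : ℂ) : ℂ :=
  G s + ∑ w ∈ W, ρ w * Complex.log (s - w)

namespace HasResidues

variable {g : ℂ → ℂ} {U : Set ℂ} {W : Finset ℂ} {ρ G : ℂ → ℂ}

theorem continuousOn_sub (h : HasResidues g U W ρ G) :
    ContinuousOn (fun s => g s - ∑ w ∈ W, ρ w / (s - w)) (U \ W) := by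
  refine h.continuousOn.sub (continuousOn_finsetSum _ fun w hw => ?_)
  refine continuousOn_const.div (continuousOn_id.sub continuousOn_const) fun s hs h0 => ?_
  exact hs.2 (by rw [sub_eq_zero.1 h0]; exact hw)

/-- `slitPrimitive` jumps where the curve crosses a slit; `logDefect` records exactly these jumps.
-/
theorem integral_curve (h : HasResidues g U W ρ G) {γ : ℝ → ℂ} (hγ : IsPiecewiseC1 γ)
    {R : ℝ} (hU : ∀ t ∈ uIcc (-R) R, γ t ∈ U) (hw : ∀ w ∈ W, ∀ t, γ t ≠ w) :
    ∫ t in (-R)..R, g (γ t) * deriv γ t =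
      slitPrimitive W ρ G (γ R) - slitPrimitive W ρ G (γ (-R)) +
        ∑ w ∈ W, ρ w * logDefect γ w R := by
  have hmem : ∀ t ∈ uIcc (-R) R, γ t ∈ U \ W := fun t ht => ⟨hU t ht, fun h0 => hw _ h0 t rfl⟩
  have hc : Continuous γ := hγ.1.continuous
  have hc1 : ContinuousOn (fun t => g (γ t) - ∑ w ∈ W, ρ w / (γ t - w)) (uIcc (-R) R) :=
    h.continuousOn_sub.comp hc.continuousOn hmem
  have e1 := integral_mul_deriv_eq_sub hγ (f := fun s => g s - ∑ w ∈ W, ρ w / (s - w)) (G := G)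
    (a := -R) (b := R) hc1 (fun t ht => h.hasDerivAt _ (hmem t ht))
  have e2 : ∫ t in (-R)..R, ∑ w ∈ W, ρ w * (deriv γ t / (γ t - w)) =
      ∑ w ∈ W, ρ w * ∫ t in (-R)..R, deriv γ t / (γ t - w) := by
    rw [intervalIntegral.integral_finsetSum fun w hw' =>
      (intervalIntegrable_deriv_div_sub hγ (hw w hw') _ _).const_mul _]
    simp only [intervalIntegral.integral_const_mul]
  have e3 : ∫ t in (-R)..R, g (γ t) * deriv γ t =
      (∫ t in (-R)..R, (g (γ t) - ∑ w ∈ W, ρ w / (γ t - w)) * deriv γ t) +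
      ∫ t in (-R)..R, ∑ w ∈ W, ρ w * (deriv γ t / (γ t - w)) := by
    rw [← intervalIntegral.integral_add
      (intervalIntegrable_mul_deriv hγ.1 hc1)]
    · refine intervalIntegral.integral_congr fun t _ => ?_
      simp only [sub_mul, Finset.sum_mul]
      rw [Finset.sum_congr rfl fun w _ => (div_mul_eq_mul_div (ρ w) (γ t - w) (deriv γ t)).trans
        (mul_div_assoc _ _ _)]
      ring
    · have := IntervalIntegrable.sum W fun w hw' =>
        (intervalIntegrable_deriv_div_sub hγ (hw w hw') (-R) R).const_mul (ρ w)
      rwa [Finset.sum_fn] at this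
  rw [e3, e1, e2]
  simp only [slitPrimitive, logDefect, mul_add, mul_sub, Finset.sum_add_distrib,
    Finset.sum_sub_distrib]
  ring

theorem integral_segment (h : HasResidues g U W ρ G) (z ζ : ℂ) {x y : ℝ}
    (hU : ∀ t ∈ uIcc x y, z + t * ζ ∈ U)
    (hw : ∀ w ∈ W, ∀ t ∈ uIcc x y, z + t * ζ - w ∈ Complex.slitPlane) :
    ζ * ∫ t in x..y, g (z + t * ζ) =
      slitPrimitive W ρ G (z + y * ζ) - slitPrimitive W ρ G (z + x * ζ) := by
  have hmem : ∀ t ∈ uIcc x y, z + (t : ℂ) * ζ ∈ U \ W := fun t ht =>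
    ⟨hU t ht, fun h0 => Complex.slitPlane_ne_zero (hw _ h0 t ht) (sub_self _)⟩
  have hline : Continuous fun t : ℝ => z + (t : ℂ) * ζ := by fun_prop
  have hc : ContinuousOn (fun t : ℝ => g (z + t * ζ)) (uIcc x y) :=
    h.continuousOn.comp hline.continuousOn hmem
  rw [← intervalIntegral.integral_const_mul]
  refine intervalIntegral.integral_eq_sub_of_hasDerivAt
    (f := fun t : ℝ => slitPrimitive W ρ G (z + t * ζ)) (fun t ht => ?_)
    (continuousOn_const.mul hc).intervalIntegrable
  have h1 : HasDerivAt (slitPrimitive W ρ G) (g (z + t * ζ)) (z + t * ζ) := by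
    have h2 := (h.hasDerivAt _ (hmem t ht)).add (HasDerivAt.fun_sum (u := W)
      (A := fun w s => ρ w * Complex.log (s - w)) fun w hw' =>
      ((((hasDerivAt_id _).sub_const w).clog (hw w hw' t ht)).const_mul (ρ w)))
    refine h2.congr_deriv ?_
    simp only [id, mul_one_div, sub_add_cancel]
  have h3 : HasDerivAt (fun t : ℝ => z + (t : ℂ) * ζ) ζ t := by
    simpa using ((hasDerivAt_id t).ofReal_comp.mul_const ζ).const_add z
  have h4 := h1.comp t h3
  rwa [mul_comm] at h4

/-- The slits run to the left from the points of `W`. The closing segments lie at heights `±R`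
beyond all of them and on a line to the right of all of them, so `slitPrimitive` is a genuine
primitive there. Its boundary values telescope and only the defects remain. -/
theorem integral_vertical (h : HasResidues g U W ρ G) {γ : ℝ → ℂ} (hγ : IsPiecewiseC1 γ)
    {X R : ℝ} (hU : ∀ t ∈ uIcc (-R) R, γ t ∈ U) (hw : ∀ w ∈ W, ∀ t, γ t ≠ w)
    (hX : ∀ w ∈ W, w.re < X)
    {x₁ x₂ : ℝ} (h₁ : γ (-R) = x₁ + (-R : ℝ) * Complex.I) (h₂ : γ R = x₂ + R * Complex.I)
    (hR : ∀ w ∈ W, |w.im| < R)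
    (hU' : ∀ s : ℂ, s.re ∈ uIcc x₁ X ∪ uIcc x₂ X → s ∈ U) :
    (∫ t in (-R)..R, g (γ t) * deriv γ t) + (∫ x in x₂..X, g (x + R * Complex.I)) -
      Complex.I * (∫ y in (-R)..R, g (X + y * Complex.I)) -
      (∫ x in x₁..X, g (x + (-R : ℝ) * Complex.I)) = ∑ w ∈ W, ρ w * logDefect γ w R := by
  have s1 := h.integral_segment (R * Complex.I) 1 (x := x₂) (y := X)
    (fun t ht => hU' _ (Or.inr (by simpa using ht)))
    (fun w hw' t _ => Or.inr (by
      have := (abs_lt.1 (hR w hw')).2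
      simp; linarith))
  have s2 := h.integral_segment ((-R : ℝ) * Complex.I) 1 (x := x₁) (y := X)
    (fun t ht => hU' _ (Or.inl (by simpa using ht)))
    (fun w hw' t _ => Or.inr (by
      have := (abs_lt.1 (hR w hw')).1
      simp; linarith))
  have s3 := h.integral_segment (X : ℂ) Complex.I (x := -R) (y := R)
    (fun t ht => hU' _ (Or.inr (by simp)))
    (fun w hw' t _ => Or.inl (by simpa using hX w hw'))
  have e1 : ∀ x y : ℝ, (y * Complex.I : ℂ) + x * 1 = x + y * Complex.I := fun x y => by ring
  simp only [e1, one_mul] at s1 s2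
  rw [s1, s2, s3, h.integral_curve hγ hU hw, h₁, h₂]
  ring

theorem integral_rightLoop (h : HasResidues g U W ρ G) {γ : ℝ → ℂ} (hγ : IsPiecewiseC1 γ)
    {X : ℝ} (hU : ∀ t ∈ uIcc (-X) X, γ t ∈ U) (hw : ∀ w ∈ W, ∀ t, γ t ≠ w)
    (hX : ∀ w ∈ W, w.re < X)
    {y₁ y₂ : ℝ} (h₁ : γ (-X) = X + y₁ * Complex.I) (h₂ : γ X = X + y₂ * Complex.I)
    (hU' : ∀ s : ℂ, s.re = X → s ∈ U) :
    (∫ t in (-X)..X, g (γ t) * deriv γ t) -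
      Complex.I * (∫ y in y₁..y₂, g (X + y * Complex.I)) = ∑ w ∈ W, ρ w * logDefect γ w X := by
  have s3 := h.integral_segment (X : ℂ) Complex.I (x := y₁) (y := y₂)
    (fun t ht => hU' _ (by simp))
    (fun w hw' t _ => Or.inl (by simpa using hX w hw'))
  rw [s3, h.integral_curve hγ hU hw, h₁, h₂]
  ring

end HasResidues

end MeijerG
end

/-! ### Absolute convergence along the ends of the paths. -/

noncomputable section
namespace MeijerG

open MeasureTheory Set Filter

theorem exists_one_add_pow_le_exp (A : ℕ) {ε : ℝ} (hε : 0 < ε) :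
    ∃ C : ℝ, 0 ≤ C ∧ ∀ x : ℝ, 0 ≤ x → (1 + x) ^ A ≤ C * Real.exp (ε * x) := by
  refine ⟨A.factorial * Real.exp ε / ε ^ A, by positivity, fun x hx => ?_⟩
  have h := Real.pow_div_factorial_le_exp (ε * (1 + x)) (by positivity) A
  rw [div_le_iff₀ (by positivity), mul_pow, mul_add, Real.exp_add, mul_one] at h
  rw [div_mul_eq_mul_div, le_div_iff₀ (by positivity)]
  linarith

/-- The polynomial factor is absorbed by an arbitrarily small exponential rate; later `ε` is half of
the available decay or less. -/
theorem ExpPolyBound.exists_norm_le {D : Set ℂ} {h : ℂ → ℂ} {u v : ℝ} (H : ExpPolyBound D h u v)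
    {ε : ℝ} (hε : 0 < ε) : ∃ C : ℝ, 0 ≤ C ∧ ∀ s ∈ D,
      ‖h s‖ ≤ C * Real.exp (u * s.re + v * |s.im| + ε * (|s.re| + |s.im|)) := by
  obtain ⟨C, A, hC, hb⟩ := H
  obtain ⟨C', hC', hA⟩ := exists_one_add_pow_le_exp A hε
  refine ⟨C * C', by positivity, fun s hs => (hb s hs).trans ?_⟩
  have h1 : (1 + ‖s‖) ^ A ≤ C' * Real.exp (ε * (|s.re| + |s.im|)) := by
    refine (hA _ (norm_nonneg s)).trans (mul_le_mul_of_nonneg_left ?_ hC')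
    exact Real.exp_le_exp.2 (mul_le_mul_of_nonneg_left (Complex.norm_le_abs_re_add_abs_im s) hε.le)
  rw [add_comm _ (ε * _), Real.exp_add (ε * _), ← mul_assoc]
  refine mul_le_mul_of_nonneg_right ?_ (Real.exp_pos _).le
  rw [mul_assoc]
  exact mul_le_mul_of_nonneg_left h1 hC

theorem integrable_of_norm_le_exp_neg_abs {f : ℝ → ℂ} (hf : LocallyIntegrable f) {C c T : ℝ}
    (hc : 0 < c) (h : ∀ t, T ≤ |t| → ‖f t‖ ≤ C * Real.exp (-c * |t|)) : Integrable f := by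
  have hexp : IntegrableAtFilter (fun t : ℝ => Real.exp (-c * t)) atTop volume :=
    ⟨Ioi 0, Ioi_mem_atTop 0, integrableOn_exp_mul_Ioi (by linarith) 0⟩
  have hexp' : IntegrableAtFilter (fun t : ℝ => Real.exp (c * t)) atBot volume :=
    ⟨Iic 0, Iic_mem_atBot 0, integrableOn_exp_mul_Iic hc 0⟩
  refine hf.integrable_of_isBigO_atBot_atTop (g := fun t => Real.exp (c * t))
    (g' := fun t => Real.exp (-c * t)) ?_ hexp' ?_ hexp
  · refine Asymptotics.IsBigO.of_bound C ?_
    filter_upwards [eventually_le_atBot (-T), eventually_le_atBot 0] with t ht h0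
    have := h t (by rw [abs_of_nonpos h0]; linarith)
    rw [abs_of_nonpos h0, neg_mul_neg] at this
    rwa [Real.norm_of_nonneg (Real.exp_pos _).le]
  · refine Asymptotics.IsBigO.of_bound C ?_
    filter_upwards [eventually_ge_atTop T, eventually_ge_atTop 0] with t ht h0
    have := h t (by rwa [abs_of_nonneg h0])
    rw [abs_of_nonneg h0] at this
    rwa [Real.norm_of_nonneg (Real.exp_pos _).le]

theorem deriv_eq_of_eqOn_ray {γ : ℝ → ℂ} {T : ℝ} {z ζ : ℂ}
    (h : ∀ t, T ≤ t → γ t = z + t * ζ) {t : ℝ} (ht : T < t) : deriv γ t = ζ := by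
  have h1 : HasDerivAt (fun x : ℝ => z + (x : ℂ) * ζ) ζ t := by
    simpa using ((hasDerivAt_id t).ofReal_comp.mul_const ζ).const_add z
  refine (h1.congr_of_eventuallyEq ?_).deriv
  filter_upwards [Ioi_mem_nhds ht] with x hx using h x (le_of_lt hx)

theorem deriv_eq_of_eqOn_ray_left {γ : ℝ → ℂ} {T : ℝ} {z ζ : ℂ}
    (h : ∀ t, t ≤ T → γ t = z + t * ζ) {t : ℝ} (ht : t < T) : deriv γ t = ζ := by
  have h1 : HasDerivAt (fun x : ℝ => z + (x : ℂ) * ζ) ζ t := by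
    simpa using ((hasDerivAt_id t).ofReal_comp.mul_const ζ).const_add z
  refine (h1.congr_of_eventuallyEq ?_).deriv
  filter_upwards [Iio_mem_nhds ht] with x hx using h x (le_of_lt hx)

/-- `g` is of exponential type `v` in `|im s|` on the parts of large `|im s|` of right half-planes. -/
def HighBound (g : ℂ → ℂ) (v : ℝ) : Prop :=
  ∀ B : ℝ, ∃ Y u : ℝ, ExpPolyBound {s | -B ≤ s.re ∧ Y ≤ |s.im|} g u v

theorem HighBound.exists_norm_le {g : ℂ → ℂ} {κ : ℝ} (hκ : 0 < κ) (h : HighBound g (-κ))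
    (B : ℝ) : ∃ Y C : ℝ, 0 ≤ C ∧
      ∀ s : ℂ, |s.re| ≤ B → Y ≤ |s.im| → ‖g s‖ ≤ C * Real.exp (-(κ / 2) * |s.im|) := by
  obtain ⟨Y, u, H⟩ := h B
  obtain ⟨C, hC, hb⟩ := H.exists_norm_le (ε := κ / 2) (by positivity)
  refine ⟨Y, C * Real.exp ((|u| + κ / 2) * B), by positivity, fun s hs hY => ?_⟩
  refine (hb s ⟨(abs_le.1 hs).1, hY⟩).trans ?_
  rw [mul_assoc, ← Real.exp_add]
  refine mul_le_mul_of_nonneg_left (Real.exp_le_exp.2 ?_) hC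
  have h1 : u * s.re ≤ |u| * B := by
    refine (le_abs_self _).trans ?_
    rw [abs_mul]
    exact mul_le_mul_of_nonneg_left hs (abs_nonneg u)
  have h2 : κ / 2 * |s.re| ≤ κ / 2 * B := mul_le_mul_of_nonneg_left hs (by positivity)
  linarith

theorem integrable_vertical {g : ℂ → ℂ} {κ : ℝ} (hκ : 0 < κ) (h : HighBound g (-κ)) {γ : ℝ → ℂ}
    (hγ : IsPiecewiseC1 γ) (hv : IsVertical γ) (hg : Continuous fun t => g (γ t)) :
    Integrable fun t => g (γ t) * deriv γ t := by
  obtain ⟨x₁, x₂, T, h₁, h₂⟩ := hv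
  obtain ⟨Y, C, hC, hb⟩ := h.exists_norm_le hκ (|x₁| + |x₂|)
  refine integrable_of_norm_le_exp_neg_abs (C := C) (c := κ / 2) (T := max Y (|T| + 1))
    (locallyIntegrable_mul_deriv hγ.1 hg) (by positivity) fun t ht => ?_
  have ht1 := (le_max_left _ _).trans ht
  have ht2 := (le_max_right _ _).trans ht
  rcases le_total 0 t with h0 | h0
  · rw [abs_of_nonneg h0] at ht2
    have hT : T < t := by linarith [le_abs_self T]
    rw [norm_mul, deriv_eq_of_eqOn_ray h₂ hT, Complex.norm_I, mul_one, h₂ t hT.le]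
    have := hb (x₂ + t * Complex.I) (by simp) (by simpa using ht1)
    simpa using this
  · rw [abs_of_nonpos h0] at ht2
    have hT : t < -T := by linarith [le_abs_self T]
    rw [norm_mul, deriv_eq_of_eqOn_ray_left h₁ hT, Complex.norm_I, mul_one, h₁ t hT.le]
    have := hb (x₁ + t * Complex.I) (by simp) (by simpa using ht1)
    simpa using this

/-- Decay is demanded only at heights `y` whose rays are eventually covered by the curve: at other
heights there may be poles arbitrarily far to the right. -/
theorem integrable_rightLoop {g : ℂ → ℂ} {γ : ℝ → ℂ} (hγ : IsPiecewiseC1 γ) (hr : IsRightLoop γ)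
    (hg : Continuous fun t => g (γ t))
    (h : ∀ y : ℝ, (∃ T : ℝ, ∀ t, T ≤ t → ∃ t', γ t' = t + y * Complex.I) →
      ∃ T u v : ℝ, u < 0 ∧ ExpPolyBound {s | T ≤ s.re ∧ s.im = y} g u v) :
    Integrable fun t => g (γ t) * deriv γ t := by
  obtain ⟨y₁, y₂, T, h₁, h₂⟩ := hr
  have key : ∀ y : ℝ, (∃ T : ℝ, ∀ t, T ≤ t → ∃ t', γ t' = t + y * Complex.I) →
      ∃ T C c : ℝ, 0 < c ∧ ∀ t : ℝ, T ≤ t → ‖g (t + y * Complex.I)‖ ≤ C * Real.exp (-c * t) := by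
    intro y hy
    obtain ⟨T', u, v, hu, H⟩ := h y hy
    obtain ⟨C, hC, hb⟩ := H.exists_norm_le (ε := -u / 2) (by linarith)
    refine ⟨max T' 0, C * Real.exp (v * |y| + -u / 2 * |y|), -u / 2, by linarith, fun t ht => ?_⟩
    refine (hb _ (by simpa using (le_max_left _ _).trans ht)).trans (le_of_eq ?_)
    have h0 : 0 ≤ t := (le_max_right _ _).trans ht
    rw [mul_assoc, ← Real.exp_add]
    simp only [Complex.add_re, Complex.ofReal_re, Complex.mul_re, Complex.I_re, Complex.ofReal_im,
      Complex.I_im, Complex.add_im, Complex.mul_im, mul_zero, mul_one, sub_zero, add_zero, zero_add,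
      abs_of_nonneg h0]
    ring_nf
  obtain ⟨T₂, C₂, c₂, hc₂, hb₂⟩ := key y₂ ⟨T, fun t ht => ⟨t, h₂ t ht⟩⟩
  obtain ⟨T₁, C₁, c₁, hc₁, hb₁⟩ := key y₁ ⟨T, fun t ht => ⟨-t, by
    rw [h₁ (-t) (by linarith)]; simp⟩⟩
  have hC : ∀ {C c t : ℝ}, min c₁ c₂ ≤ c → C ≤ |C₁| + |C₂| → 0 ≤ t →
      C * Real.exp (-c * t) ≤ (|C₁| + |C₂|) * Real.exp (-min c₁ c₂ * t) := by
    intro C c t hc hC' ht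
    refine mul_le_mul hC' (Real.exp_le_exp.2 ?_) (Real.exp_pos _).le (by positivity)
    nlinarith
  refine integrable_of_norm_le_exp_neg_abs (C := |C₁| + |C₂|) (c := min c₁ c₂)
    (T := max (max T₁ T₂) (|T| + 1)) (locallyIntegrable_mul_deriv hγ.1 hg) (lt_min hc₁ hc₂)
    fun t ht => ?_
  have ht1 := ((le_max_left _ _).trans (le_max_left _ _)).trans ht
  have ht2 := ((le_max_right _ _).trans (le_max_left _ _)).trans ht
  have ht3 := (le_max_right _ _).trans ht
  rcases le_total 0 t with h0 | h0
  · rw [abs_of_nonneg h0] at *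
    have hT : T < t := by linarith [le_abs_self T]
    have hd : deriv γ t = 1 := deriv_eq_of_eqOn_ray (z := y₂ * Complex.I) (ζ := 1)
      (fun t ht => by rw [h₂ t ht]; ring) hT
    rw [norm_mul, hd, norm_one, mul_one, h₂ t hT.le]
    exact (hb₂ t ht2).trans (hC (min_le_right _ _)
      ((le_abs_self _).trans (le_add_of_nonneg_left (abs_nonneg _))) h0)
  · rw [abs_of_nonpos h0] at *
    have hT : t < -T := by linarith [le_abs_self T]
    have hd : deriv γ t = -1 := deriv_eq_of_eqOn_ray_left (z := y₁ * Complex.I) (ζ := -1)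
      (fun t ht => by rw [h₁ t ht]; ring) hT
    rw [norm_mul, hd, norm_neg, norm_one, mul_one, h₁ t hT.le]
    have := (hb₁ (-t) ht1).trans (hC (t := -t) (min_le_left _ _)
      ((le_abs_self _).trans (le_add_of_nonneg_right (abs_nonneg _))) (by linarith))
    simpa using this

end MeijerG
end

/-! ### Closing the paths on the right by vertical lines. -/

noncomputable section
namespace MeijerG

open MeasureTheory Set Filter

/-- The open vertical strip `-B < re s < X`. -/
def strip (B X : ℝ) : Set ℂ := {s | -B < s.re ∧ s.re < X}

variable {g : ℂ → ℂ} {γ : ℝ → ℂ} {W : Finset ℂ} {ρ G : ℂ → ℂ} {φ : ℂ → ℝ} {B X X' κ : ℝ}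

theorem HasResidues.continuous_line (h : HasResidues g (strip B X') W ρ G) (hB : -B < X)
    (hX' : X < X') (hX : ∀ w ∈ W, w.re < X) : Continuous fun y : ℝ => g (X + y * Complex.I) := by
  have hline : Continuous fun y : ℝ => (X : ℂ) + y * Complex.I := by fun_prop
  refine h.continuousOn.comp_continuous hline fun y => ⟨⟨by simpa, by simpa⟩, fun h0 => ?_⟩
  have := hX _ h0
  simp at this

theorem integrable_line (hκ : 0 < κ) (hb : HighBound g (-κ))
    (hc : Continuous fun y : ℝ => g (X + y * Complex.I)) :
    Integrable fun y : ℝ => g (X + y * Complex.I) := by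
  obtain ⟨Y, C, hC, hb⟩ := hb.exists_norm_le hκ |X|
  refine integrable_of_norm_le_exp_neg_abs (C := C) (c := κ / 2) (T := Y) hc.locallyIntegrable
    (by positivity) fun t ht => ?_
  have := hb (X + t * Complex.I) (by simp) (by simpa using ht)
  simpa using this

theorem tendsto_integral_horizontal (hκ : 0 < κ) (hb : HighBound g (-κ)) (x y : ℝ) {σ : ℝ}
    (hσ : |σ| = 1) :
    Tendsto (fun R : ℝ => ∫ t in x..y, g (t + (σ * R : ℝ) * Complex.I)) atTop (𝓝 0) := by
  obtain ⟨Y, C, hC, hb⟩ := hb.exists_norm_le hκ (|x| + |y|)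
  have hlim : Tendsto (fun R : ℝ => C * Real.exp (-(κ / 2) * R) * |y - x|) atTop (𝓝 0) := by
    have : Tendsto (fun R : ℝ => Real.exp (-(κ / 2) * R)) atTop (𝓝 0) :=
      Real.tendsto_exp_atBot.comp (tendsto_id.const_mul_atTop_of_neg (by linarith))
    simpa using (this.const_mul C).mul_const |y - x|
  refine squeeze_zero_norm' ?_ hlim
  filter_upwards [eventually_ge_atTop Y, eventually_ge_atTop 0] with R hR h0
  have hR' : |σ * R| = R := by rw [abs_mul, hσ, one_mul, abs_of_nonneg h0]
  refine intervalIntegral.norm_integral_le_of_norm_le_const fun t ht => ?_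
  have ht' : |t| ≤ |x| + |y| := by
    have h1 := uIoc_subset_uIcc ht
    rcases le_total x y with hxy | hxy
    · rw [uIcc_of_le hxy] at h1
      exact abs_le.2 ⟨by linarith [h1.1, neg_abs_le x, abs_nonneg y],
        by linarith [h1.2, le_abs_self y, abs_nonneg x]⟩
    · rw [uIcc_of_ge hxy] at h1
      exact abs_le.2 ⟨by linarith [h1.1, neg_abs_le y, abs_nonneg x],
        by linarith [h1.2, le_abs_self x, abs_nonneg y]⟩
  have := hb (t + (σ * R : ℝ) * Complex.I)
    (by simpa using ht') (by simp [-Complex.ofReal_mul, hR', hR])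
  simpa [-Complex.ofReal_mul, hR'] using this

theorem integral_vertical_sub_eq (h : HasResidues g (strip B X') W ρ G) (hX' : X < X')
    (hX : ∀ w ∈ W, w.re < X) (hκ : 0 < κ) (hb : HighBound g (-κ)) (hγ : IsPiecewiseC1 γ)
    (hv : IsVertical γ) (hγB : ∀ t, -B < (γ t).re) (hγX : ∀ t, (γ t).re ≤ X)
    (hφ : ∀ w ∈ W, ArgChange γ w (φ w + Real.pi))
    (hint : Integrable fun t => g (γ t) * deriv γ t) :
    (∫ t, g (γ t) * deriv γ t) - Complex.I * (∫ y : ℝ, g (X + y * Complex.I)) =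
      ∑ w ∈ W, ρ w * (Complex.I * φ w) := by
  obtain ⟨x₁, x₂, T, h₁, h₂⟩ := hv
  have hline := integrable_line hκ hb
    (h.continuous_line ((hγB 0).trans_le (hγX 0)) hX' hX)
  have l1 := intervalIntegral_tendsto_integral hint tendsto_neg_atTop_atBot tendsto_id
  have l2 := (intervalIntegral_tendsto_integral hline tendsto_neg_atTop_atBot
    tendsto_id).const_mul Complex.I
  have l3 := tendsto_integral_horizontal hκ hb x₂ X (σ := 1) (by simp)
  have l4 := tendsto_integral_horizontal hκ hb x₁ X (σ := -1) (by simp)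
  have l := ((l1.add l3).sub l2).sub l4
  rw [add_zero, sub_zero] at l
  refine tendsto_nhds_unique l (tendsto_const_nhds.congr' ?_)
  obtain ⟨M, hM⟩ : ∃ M : ℝ, ∀ w ∈ W, |w.im| < M := by
    refine ⟨∑ w ∈ W, |w.im| + 1, fun w hw => ?_⟩
    have := Finset.single_le_sum (f := fun w : ℂ => |w.im|) (fun i _ => abs_nonneg _) hw
    linarith
  filter_upwards [eventually_ge_atTop T, eventually_ge_atTop M] with R hRT hRM
  have hRw : ∀ w ∈ W, |w.im| < R := fun w hw => (hM w hw).trans_le hRM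
  have e₁ := h₁ (-R) (by linarith)
  have e₂ := h₂ R hRT
  have b1 : -B < x₁ := by simpa [e₁] using hγB (-R)
  have b2 : -B < x₂ := by simpa [e₂] using hγB R
  have b3 : x₁ ≤ X := by simpa [e₁] using hγX (-R)
  have b4 : x₂ ≤ X := by simpa [e₂] using hγX R
  have key := h.integral_vertical hγ (X := X) (R := R)
    (fun t _ => ⟨hγB t, (hγX t).trans_lt hX'⟩) (fun w hw => (hφ w hw).1) hX e₁ e₂ hRw
    (fun s hs => by
      rw [uIcc_of_le b3, uIcc_of_le b4] at hs
      rcases hs with hs | hs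
      · exact ⟨b1.trans_le hs.1, hs.2.trans_lt hX'⟩
      · exact ⟨b2.trans_le hs.1, hs.2.trans_lt hX'⟩)
  have hL : ∀ w ∈ W, logDefect γ w R = Complex.I * φ w := by
    intro w hw
    have := logDefect_eq hγ (hφ w hw) (T := T) (z₁ := x₁) (z₂ := x₂) (ζ₁ := -Complex.I)
      (ζ₂ := Complex.I) (Or.inr (by simp)) (Or.inr (by simp))
      (fun t ht => by rw [h₁ (-t) (by linarith)]; push_cast; ring) h₂ (R := R)
      (fun t ht => by
        rw [h₁ t (by linarith)]
        have := (abs_lt.1 (hRw w hw)).1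
        exact Or.inr (by simp; linarith))
      (fun t ht => by
        rw [h₂ t (by linarith)]
        have := (abs_lt.1 (hRw w hw)).2
        exact Or.inr (by simp; linarith))
    -- The ends point to `-i` and `i`, so the defect is `i` times `φ + π - π/2 - π/2 = φ`. This is
    -- why vertical paths carry the shift `π`.
    rw [this, Complex.arg_I, Complex.arg_neg_I]
    congr 2
    ring
  rw [Finset.sum_congr rfl fun w hw => by rw [← hL w hw], ← key]
  simp only [one_mul, neg_mul, id]

theorem integral_rightLoop_sub_eq (h : HasResidues g (strip B X') W ρ G) (hX' : X < X')
    (hX : ∀ w ∈ W, w.re < X) (hγ : IsPiecewiseC1 γ) {y₁ y₂ T : ℝ}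
    (h₁ : ∀ t : ℝ, t ≤ -T → γ t = -t + y₁ * Complex.I)
    (h₂ : ∀ t : ℝ, T ≤ t → γ t = t + y₂ * Complex.I) (hT : T ≤ X)
    (hγB : ∀ t, -B < (γ t).re) (hγX : ∀ t ∈ uIcc (-X) X, (γ t).re ≤ X)
    (hφ : ∀ w ∈ W, ArgChange γ w (φ w)) :
    (∫ t in (-X)..X, g (γ t) * deriv γ t) -
      Complex.I * (∫ y in y₁..y₂, g (X + y * Complex.I)) = ∑ w ∈ W, ρ w * (Complex.I * φ w) := by
  have hBX : -B < X := by simpa [h₂ X hT] using hγB X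
  have key := h.integral_rightLoop hγ (X := X) (y₁ := y₁) (y₂ := y₂)
    (fun t ht => ⟨hγB t, (hγX t ht).trans_lt hX'⟩) (fun w hw => (hφ w hw).1) hX
    (by rw [h₁ (-X) (by linarith)]; simp) (h₂ X hT)
    (fun s hs => ⟨by rwa [hs], by rwa [hs]⟩)
  rw [key]
  refine Finset.sum_congr rfl fun w hw => ?_
  have := logDefect_eq hγ (hφ w hw) (T := T) (z₁ := y₁ * Complex.I) (z₂ := y₂ * Complex.I)
    (ζ₁ := 1) (ζ₂ := 1) (by simp) (by simp)
    (fun t ht => by rw [h₁ (-t) (by linarith)]; push_cast; ring)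
    (fun t ht => by rw [h₂ t ht]; ring) (R := X)
    (fun t ht => by
      rw [h₁ t (by linarith)]
      have := hX w hw
      exact Or.inl (by simp; linarith))
    (fun t ht => by
      rw [h₂ t (by linarith)]
      have := hX w hw
      exact Or.inl (by simp; linarith))
  rw [this]
  simp

/-- `g` decays on the lines `re s = x + N`, `N ≥ N₀`. -/
def LineBound (g : ℂ → ℂ) (x u v : ℝ) : Prop :=
  ∃ N₀ : ℕ, ExpPolyBound {s | ∃ N : ℕ, N₀ ≤ N ∧ s.re = x + N} g u v

/-- The integral of `g` along `γ` is the limit of the sums of residues of `g` to the left of the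
lines `re s = x + N`, weighted by the change of the argument, diminished by `δ`, along `γ`. -/
def ClosesToRight (g : ℂ → ℂ) (γ : ℝ → ℂ) (x δ : ℝ) : Prop :=
  ∃ J : ℕ → ℂ, Tendsto J atTop (𝓝 (∫ t, g (γ t) * deriv γ t)) ∧
    ∀ᶠ N : ℕ in atTop, ∀ (B X' : ℝ) (W : Finset ℂ) (ρ G : ℂ → ℂ) (φ : ℂ → ℝ),
      HasResidues g (strip B X') W ρ G → x + N < X' → (∀ w ∈ W, w.re < x + N) →
      (∀ t, -B < (γ t).re) → (∀ w ∈ W, ArgChange γ w (φ w + δ)) →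
      J N = ∑ w ∈ W, ρ w * (Complex.I * φ w)

theorem IsVertical.exists_abs_re_le (hγ : Continuous γ) (hv : IsVertical γ) :
    ∃ M : ℝ, ∀ t, |(γ t).re| ≤ M := by
  obtain ⟨x₁, x₂, T, h₁, h₂⟩ := hv
  obtain ⟨M, hM⟩ := (isCompact_Icc (a := -T) (b := T)).exists_bound_of_continuousOn
    (Complex.continuous_re.comp hγ).continuousOn
  refine ⟨max M (|x₁| + |x₂|), fun t => ?_⟩
  by_cases h1 : t ≤ -T
  · rw [h₁ t h1]; simp
  by_cases h2 : T ≤ t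
  · rw [h₂ t h2]; simp
  exact (hM t ⟨by linarith, by linarith⟩).trans (le_max_left _ _)

theorem IsRightLoop.exists_le_re (hγ : Continuous γ) (hr : IsRightLoop γ) :
    ∃ M : ℝ, ∀ t, -M ≤ (γ t).re := by
  obtain ⟨y₁, y₂, T, h₁, h₂⟩ := hr
  obtain ⟨M, hM⟩ := (isCompact_Icc (a := -T) (b := T)).exists_bound_of_continuousOn
    (Complex.continuous_re.comp hγ).continuousOn
  refine ⟨max M |T|, fun t => ?_⟩
  have hT := neg_abs_le T
  have hm1 := le_max_left M |T|
  have hm2 := le_max_right M |T|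
  by_cases h1 : t ≤ -T
  · rw [h₁ t h1]; simp only [Complex.add_re, Complex.neg_re, Complex.ofReal_re, Complex.mul_re,
      Complex.I_re, Complex.I_im, Complex.ofReal_im, mul_zero, zero_mul, sub_zero, add_zero]
    linarith
  by_cases h2 : T ≤ t
  · rw [h₂ t h2]; simp only [Complex.add_re, Complex.ofReal_re, Complex.mul_re,
      Complex.I_re, Complex.I_im, Complex.ofReal_im, mul_zero, zero_mul, sub_zero, add_zero]
    linarith
  have := (abs_le.1 (hM t ⟨by linarith, by linarith⟩)).1
  simp only [Function.comp_apply] at this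
  linarith

theorem tendsto_exp_mul_add_nat {u : ℝ} (hu : u < 0) (x : ℝ) :
    Tendsto (fun N : ℕ => Real.exp (u * (x + N))) atTop (𝓝 0) :=
  Real.tendsto_exp_atBot.comp ((tendsto_atTop_add_const_left _ x
    tendsto_natCast_atTop_atTop).const_mul_atTop_of_neg hu)

/-- Subtracting the integral over the line `re s = x + N` gives the residue sum exactly. That line
integral tends to 0, since `u < 0` supplies decay in `N` and `κ > 0` integrability along the line.
-/
theorem closesToRight_of_isVertical {x u : ℝ} (hu : u < 0) (hκ : 0 < κ)
    (hb : HighBound g (-κ)) (hl : LineBound g x u (-κ)) (hγ : IsPiecewiseC1 γ) (hv : IsVertical γ)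
    (hint : Integrable fun t => g (γ t) * deriv γ t) : ClosesToRight g γ x Real.pi := by
  refine ⟨fun N => (∫ t, g (γ t) * deriv γ t) -
    Complex.I * ∫ y : ℝ, g ((x + N : ℝ) + y * Complex.I), ?_, ?_⟩
  · obtain ⟨N₀, H⟩ := hl
    obtain ⟨C, hC, hb'⟩ := H.exists_norm_le (ε := min (-u / 2) (κ / 2))
      (lt_min (by linarith) (by linarith))
    set K : ℝ := ∫ y : ℝ, Real.exp (-(κ / 2) * |y|) with hK
    have hKint : Integrable fun y : ℝ => Real.exp (-(κ / 2) * |y|) := by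
      refine (integrable_of_norm_le_exp_neg_abs (f := fun y : ℝ =>
        (Real.exp (-(κ / 2) * |y|) : ℂ)) (C := 1) (c := κ / 2) (T := 0) ?_ (by linarith) ?_).re
      · exact (Continuous.locallyIntegrable (by fun_prop))
      · intro t _
        rw [Complex.norm_real, Real.norm_of_nonneg (Real.exp_pos _).le, one_mul]
    have hlim : Tendsto (fun N : ℕ => ∫ y : ℝ, g ((x + N : ℝ) + y * Complex.I)) atTop (𝓝 0) := by
      have hz : Tendsto (fun N : ℕ => C * Real.exp (u / 2 * (x + N)) * K) atTop (𝓝 0) := by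
        simpa using ((tendsto_exp_mul_add_nat (u := u / 2) (by linarith) x).const_mul C).mul_const K
      refine squeeze_zero_norm' ?_ hz
      obtain ⟨N₁, hN₁⟩ := exists_nat_ge (-x)
      filter_upwards [eventually_ge_atTop N₀, eventually_ge_atTop N₁] with N hN hN'
      have hpos : 0 ≤ x + N := by
        have : (N₁ : ℝ) ≤ N := by exact_mod_cast hN'
        linarith
      rw [hK, ← integral_const_mul]
      refine norm_integral_le_of_norm_le (hKint.const_mul _) (Eventually.of_forall fun y => ?_)
      refine (hb' _ ⟨N, hN, by simp⟩).trans ?_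
      rw [mul_assoc, ← Real.exp_add]
      refine mul_le_mul_of_nonneg_left (Real.exp_le_exp.2 ?_) hC
      have e1 : (((x + N : ℝ) : ℂ) + y * Complex.I).re = x + N := by simp
      have e2 : (((x + N : ℝ) : ℂ) + y * Complex.I).im = y := by simp
      rw [e1, e2, abs_of_nonneg hpos]
      have m1 := min_le_left (-u / 2) (κ / 2)
      have m2 := min_le_right (-u / 2) (κ / 2)
      nlinarith [abs_nonneg y]
    simpa using (hlim.const_mul Complex.I).const_sub (∫ t, g (γ t) * deriv γ t)
  · obtain ⟨M, hM⟩ := hv.exists_abs_re_le hγ.1.continuous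
    obtain ⟨N₁, hN₁⟩ := exists_nat_ge (M - x)
    filter_upwards [eventually_ge_atTop N₁] with N hN B X' W ρ G φ h hX' hX hγB hφ
    have hN' : (N₁ : ℝ) ≤ N := by exact_mod_cast hN
    exact integral_vertical_sub_eq h hX' hX hκ hb hγ hv hγB
      (fun t => ((abs_le.1 (hM t)).2).trans (by linarith)) hφ hint

/-- The loop is cut off at `re s = x + N` and closed by a vertical segment of fixed height, so `u <
0` suffices and the sign of `v` is irrelevant. -/
theorem closesToRight_of_isRightLoop {x u v : ℝ} (hu : u < 0) (hl : LineBound g x u v)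
    (hγ : IsPiecewiseC1 γ) (hr : IsRightLoop γ)
    (hint : Integrable fun t => g (γ t) * deriv γ t) : ClosesToRight g γ x 0 := by
  obtain ⟨y₁, y₂, T, h₁, h₂⟩ := hr
  have hat : Tendsto (fun N : ℕ => x + (N : ℝ)) atTop atTop :=
    tendsto_atTop_add_const_left _ x tendsto_natCast_atTop_atTop
  refine ⟨fun N => (∫ t in (-(x + N))..(x + N), g (γ t) * deriv γ t) -
    Complex.I * ∫ y in y₁..y₂, g ((x + N : ℝ) + y * Complex.I), ?_, ?_⟩
  · obtain ⟨N₀, H⟩ := hl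
    obtain ⟨C, hC, hb'⟩ := H.exists_norm_le (ε := -u / 2) (by linarith)
    have hlim : Tendsto (fun N : ℕ => ∫ y in y₁..y₂, g ((x + N : ℝ) + y * Complex.I)) atTop
        (𝓝 0) := by
      set Y : ℝ := |y₁| + |y₂| with hY
      have hz : Tendsto (fun N : ℕ => C * Real.exp ((|v| + -u / 2) * Y) *
          Real.exp (u / 2 * (x + N)) * |y₂ - y₁|) atTop (𝓝 0) := by
        simpa using ((tendsto_exp_mul_add_nat (u := u / 2) (by linarith) x).const_mul
          (C * Real.exp ((|v| + -u / 2) * Y))).mul_const |y₂ - y₁|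
      refine squeeze_zero_norm' ?_ hz
      filter_upwards [eventually_ge_atTop N₀, hat.eventually_ge_atTop 0] with N hN hpos
      refine intervalIntegral.norm_integral_le_of_norm_le_const fun y hy => ?_
      have hy' : |y| ≤ Y := by
        have h1 := uIoc_subset_uIcc hy
        rcases le_total y₁ y₂ with hxy | hxy
        · rw [uIcc_of_le hxy] at h1
          exact abs_le.2 ⟨by linarith [h1.1, neg_abs_le y₁, abs_nonneg y₂],
            by linarith [h1.2, le_abs_self y₂, abs_nonneg y₁]⟩
        · rw [uIcc_of_ge hxy] at h1
          exact abs_le.2 ⟨by linarith [h1.1, neg_abs_le y₂, abs_nonneg y₁],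
            by linarith [h1.2, le_abs_self y₁, abs_nonneg y₂]⟩
      refine (hb' _ ⟨N, hN, by simp⟩).trans ?_
      rw [mul_assoc, ← Real.exp_add]
      refine mul_le_mul_of_nonneg_left (Real.exp_le_exp.2 ?_) hC
      have e1 : (((x + N : ℝ) : ℂ) + y * Complex.I).re = x + N := by simp
      have e2 : (((x + N : ℝ) : ℂ) + y * Complex.I).im = y := by simp
      rw [e1, e2, abs_of_nonneg hpos]
      have m1 : v * |y| ≤ |v| * Y :=
        mul_le_mul (le_abs_self v) hy' (abs_nonneg _) (abs_nonneg _)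
      nlinarith
    have hI := intervalIntegral_tendsto_integral hint (tendsto_neg_atTop_atBot.comp hat) hat
    simpa using hI.sub (hlim.const_mul Complex.I)
  · obtain ⟨M, hM⟩ := (isCompact_Icc (a := -T) (b := T)).exists_bound_of_continuousOn
      (Complex.continuous_re.comp hγ.1.continuous).continuousOn
    filter_upwards [hat.eventually_ge_atTop M, hat.eventually_ge_atTop T,
      hat.eventually_ge_atTop 0] with N hNM hNT hN0 B X' W ρ G φ h hX' hX hγB hφ
    refine integral_rightLoop_sub_eq h hX' hX hγ h₁ h₂ hNT hγB (fun t ht => ?_)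
      (fun w hw => by simpa using hφ w hw)
    rw [uIcc_of_le (by linarith)] at ht
    by_cases c1 : t ≤ -T
    · rw [h₁ t c1]
      have := ht.1
      simp; linarith
    by_cases c2 : T ≤ t
    · rw [h₂ t c2]
      have := ht.2
      simp; linarith
    exact ((le_abs_self _).trans (hM t ⟨by linarith, by linarith⟩)).trans hNM

end MeijerG
end

/-! ### Analyticity and bounds of the integrand; convergence of the integrals. -/

noncomputable section
namespace MeijerG

open MeasureTheory Set Filter

variable {p q : ℕ}

/-- The Mellin-Barnes integrand with arbitrary sets of indices for the four products. -/
def gammaQuotient (S S' : Finset (Fin q)) (T T' : Finset (Fin p)) (a : Fin p → ℂ) (b : Fin q → ℂ)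
    (ω s : ℂ) : ℂ :=
  Complex.exp (s * ω) *
    (((∏ l ∈ S, Complex.Gamma (b l - s)) * (∏ l ∈ T, Complex.Gamma (1 - a l + s))) /
      ((∏ l ∈ S', Complex.Gamma (1 - b l + s)) * (∏ l ∈ T', Complex.Gamma (a l - s))))

theorem differentiable_inv_Gamma_comp {f : ℂ → ℂ} (hf : Differentiable ℂ f) :
    Differentiable ℂ fun s => (Complex.Gamma (f s))⁻¹ :=
  Complex.differentiable_one_div_Gamma.comp hf

theorem gammaQuotient_eq (S S' : Finset (Fin q)) (T T' : Finset (Fin p)) (a : Fin p → ℂ)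
    (b : Fin q → ℂ) (ω : ℂ) : gammaQuotient S S' T T' a b ω = fun s => Complex.exp (s * ω) *
      (((∏ l ∈ S, Complex.Gamma (b l - s)) * (∏ l ∈ T, Complex.Gamma (1 - a l + s))) *
      ((∏ l ∈ S', (Complex.Gamma (1 - b l + s))⁻¹) * (∏ l ∈ T', (Complex.Gamma (a l - s))⁻¹))) := by
  funext s
  rw [gammaQuotient, div_eq_mul_inv, mul_inv, Finset.prod_inv_distrib, Finset.prod_inv_distrib]

theorem differentiableAt_gammaQuotient {S S' : Finset (Fin q)} {T T' : Finset (Fin p)}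
    {a : Fin p → ℂ} {b : Fin q → ℂ} {ω s : ℂ} (hS : ∀ l ∈ S, ∀ r : ℕ, s ≠ b l + r)
    (hT : ∀ l ∈ T, ∀ r : ℕ, s ≠ a l - 1 - r) :
    DifferentiableAt ℂ (gammaQuotient S S' T T' a b ω) s := by
  rw [gammaQuotient_eq]
  refine DifferentiableAt.mul (by fun_prop) (DifferentiableAt.mul (DifferentiableAt.mul ?_ ?_)
    (DifferentiableAt.mul ?_ ?_))
  · refine DifferentiableAt.fun_finsetProd fun l hl => ?_
    refine (Complex.differentiableAt_Gamma (b l - s) fun r h => hS l hl r ?_).comp s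
      (f := fun s => b l - s) (by fun_prop)
    linear_combination -h
  · refine DifferentiableAt.fun_finsetProd fun l hl => ?_
    refine (Complex.differentiableAt_Gamma (1 - a l + s) fun r h => hT l hl r ?_).comp s
      (f := fun s => 1 - a l + s) (by fun_prop)
    linear_combination h
  · exact DifferentiableAt.fun_finsetProd fun l _ =>
      (differentiable_inv_Gamma_comp (by fun_prop)) s
  · exact DifferentiableAt.fun_finsetProd fun l _ =>
      (differentiable_inv_Gamma_comp (by fun_prop)) s

theorem meromorphicAt_Gamma_comp {f : ℂ → ℂ} (hf : Differentiable ℂ f) (s : ℂ) :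
    MeromorphicAt (fun s => Complex.Gamma (f s)) s := by
  have := ((differentiable_inv_Gamma_comp hf).analyticAt s).meromorphicAt.inv
  simpa only [Pi.inv_def, inv_inv] using this

theorem meromorphicAt_gammaQuotient (S S' : Finset (Fin q)) (T T' : Finset (Fin p))
    (a : Fin p → ℂ) (b : Fin q → ℂ) (ω s : ℂ) :
    MeromorphicAt (gammaQuotient S S' T T' a b ω) s := by
  have hexp : AnalyticAt ℂ (fun s : ℂ => Complex.exp (s * ω)) s :=
    (show Differentiable ℂ fun s : ℂ => Complex.exp (s * ω) by fun_prop).analyticAt s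
  refine hexp.meromorphicAt.mul (MeromorphicAt.div (MeromorphicAt.mul ?_ ?_)
    (MeromorphicAt.mul ?_ ?_))
  all_goals
    exact MeromorphicAt.fun_prod fun l _ => meromorphicAt_Gamma_comp (by fun_prop) s

theorem continuous_integrand_comp {M N : ℕ} {a : Fin p → ℂ} {b : Fin q → ℂ} {ω : ℂ} {γ : ℝ → ℂ}
    (hγ : Continuous γ) (hl : ∀ w ∈ leftPoles N a, ∀ t, γ t ≠ w)
    (hr : ∀ w ∈ rightPoles M b, ∀ t, γ t ≠ w) : Continuous fun t => integrand M N a b ω (γ t) := by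
  refine continuous_iff_continuousAt.2 fun t => ContinuousAt.comp (g := integrand M N a b ω) ?_
    hγ.continuousAt
  refine (differentiableAt_gammaQuotient (S := {l | l.val < M}) (T := {l | l.val < N})
    (fun l h r => ?_) fun l h r => ?_).continuousAt
  · exact hr _ ⟨l, by simpa using h, r, rfl⟩ t
  · exact hl _ ⟨l, by simpa using h, r, rfl⟩ t

theorem ExpPolyBound.mono {D D' : Set ℂ} {h h' : ℂ → ℂ} {u v : ℝ} (H : ExpPolyBound D h u v)
    (hD : D' ⊆ D) (hh : ∀ s ∈ D', h' s = h s) : ExpPolyBound D' h' u v := by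
  obtain ⟨C, A, hC, hb⟩ := H
  exact ⟨C, A, hC, fun s hs => hh s hs ▸ hb s (hD hs)⟩

theorem HighBound.congr {f g : ℂ → ℂ} {v Y₀ : ℝ} (h : HighBound f v)
    (hfg : ∀ s : ℂ, Y₀ ≤ |s.im| → g s = f s) : HighBound g v := by
  intro B
  obtain ⟨Y, u, H⟩ := h B
  exact ⟨max Y Y₀, u, H.mono (fun s hs => ⟨hs.1, (le_max_left _ _).trans hs.2⟩)
    fun s hs => hfg s ((le_max_right _ _).trans hs.2)⟩

theorem LineBound.congr {f g : ℂ → ℂ} {x u v X₀ : ℝ} (h : LineBound f x u v)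
    (hfg : ∀ s : ℂ, X₀ ≤ s.re → g s = f s) : LineBound g x u v := by
  obtain ⟨N₀, H⟩ := h
  obtain ⟨N₁, hN₁⟩ := exists_nat_ge (X₀ - x)
  refine ⟨max N₀ N₁, H.mono (fun s ⟨N, hN, hs⟩ => ⟨N, (le_max_left _ _).trans hN, hs⟩)
    fun s ⟨N, hN, hs⟩ => hfg s ?_⟩
  have : (N₁ : ℝ) ≤ N := by exact_mod_cast (le_max_right _ _).trans hN
  rw [hs]; linarith

theorem exists_forall_le_of_fin {n : ℕ} (f : Fin n → ℝ) : ∃ C : ℝ, 0 ≤ C ∧ ∀ l, f l ≤ C := by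
  refine ⟨∑ l, |f l|, by positivity, fun l => (le_abs_self _).trans ?_⟩
  exact Finset.single_le_sum (f := fun l => |f l|) (fun i _ => abs_nonneg _) (Finset.mem_univ l)

theorem highBound_integrand {P Q M N : ℕ} (hPQ : P ≤ Q) (hM : M ≤ Q) (hN : N ≤ P)
    (a : Fin P → ℂ) (b : Fin Q → ℂ) (ω : ℂ) :
    HighBound (integrand M N a b ω)
    (|ω.im| - ((M : ℝ) + N - ((P : ℝ) + Q) / 2) * Real.pi) := by
  intro B
  obtain ⟨A, hA0, hA⟩ := exists_forall_le_of_fin fun l => |(a l).im|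
  obtain ⟨A', hA0', hA'⟩ := exists_forall_le_of_fin fun l => |(b l).im|
  -- At this height `s` is at vertical distance at least 1 from all `a_l` and `b_l`. `K = 0` is
  -- enough because `HighBound` leaves the exponent in `re s` free.
  refine ⟨1 + A + A', _, expPolyBound_integrand hPQ hM hN a b ω (B := B) (fun s hs => hs.1)
    (fun s hs l => Or.inr ?_) (fun l _ => sinLowerBound_of_im one_pos fun s hs => ?_) 0⟩
  · have h1 := hA l
    have h2 := abs_sub_abs_le_abs_sub s.im (a l).im
    have h3 := hs.2
    simp only [Complex.add_im, Complex.sub_im, Complex.one_im, zero_sub, ← sub_eq_add_neg]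
    linarith
  · have h1 := hA' l
    have h2 := abs_sub_abs_le_abs_sub s.im (b l).im
    have h3 := hs.2
    rw [abs_sub_comm]
    linarith

theorem lineBound_integrand {P Q M N : ℕ} (hPQ : P ≤ Q) (hM : M ≤ Q) (hN : N ≤ P)
    (a : Fin P → ℂ) (b : Fin Q → ℂ) (ω : ℂ)
    {x : ℝ} (hx : ∀ l, ∀ j : ℤ, (b l).re - x ≠ j) (K : ℝ) :
    LineBound (integrand M N a b ω) x (ω.re - ((Q : ℝ) - P) * K)
      (|ω.im| - ((M : ℝ) + N - ((P : ℝ) + Q) / 2) * Real.pi) := by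
  obtain ⟨A, hA0, hA⟩ := exists_forall_le_of_fin fun l => (a l).re
  obtain ⟨N₀, hN₀⟩ := exists_nat_ge (A - x)
  refine ⟨N₀, expPolyBound_integrand hPQ hM hN a b ω (B := |x|) ?_ ?_
    (fun l _ => sinLowerBound_of_re (hx l) ?_) K⟩
  · rintro s ⟨N, hN, hs⟩
    have := neg_abs_le x
    have h2 : (0 : ℝ) ≤ N := Nat.cast_nonneg N
    rw [hs]; linarith
  · rintro s ⟨N, hN, hs⟩ l
    have h1 := hA l
    have h2 : (N₀ : ℝ) ≤ N := by exact_mod_cast hN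
    refine Or.inl ?_
    simp only [Complex.add_re, Complex.sub_re, Complex.one_re, hs]
    linarith
  · rintro s ⟨N, -, hs⟩
    exact ⟨N, hs⟩

theorem rowBound_integrand {P Q M N : ℕ} (hPQ : P ≤ Q) (hM : M ≤ Q) (hN : N ≤ P)
    (a : Fin P → ℂ) (b : Fin Q → ℂ) (ω : ℂ)
    {y : ℝ} (hy : ∀ l : Fin Q, l.val < M → (b l).im ≠ y) (K : ℝ) :
    ∃ T : ℝ, ExpPolyBound {s | T ≤ s.re ∧ s.im = y} (integrand M N a b ω)
      (ω.re - ((Q : ℝ) - P) * K) (|ω.im| - ((M : ℝ) + N - ((P : ℝ) + Q) / 2) * Real.pi) := by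
  obtain ⟨A, hA0, hA⟩ := exists_forall_le_of_fin fun l => (a l).re
  refine ⟨A, expPolyBound_integrand hPQ hM hN a b ω (B := 0) (fun s hs => ?_)
    (fun s hs l => Or.inl ?_)
    (fun l hl => sinLowerBound_of_im (abs_pos.2 (sub_ne_zero.2 (hy l hl))) fun s hs => ?_) K⟩
  · have := hs.1
    linarith
  · have h1 := hA l
    have h2 := hs.1
    simp only [Complex.add_re, Complex.sub_re, Complex.one_re]
    linarith
  · rw [hs.2]

/-- Provides the decay to the right: unpaired reciprocal Gamma factors beat any `|z|^(re s)`, and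
without them `|z| < 1` is needed. -/
theorem exists_sub_mul_neg {P Q : ℕ} {x : ℝ} (hPQ : P ≤ Q) (h : P < Q ∨ x < 0) :
    ∃ K : ℝ, x - ((Q : ℝ) - P) * K < 0 := by
  rcases hPQ.eq_or_lt with rfl | h'
  · exact ⟨0, by simpa using h⟩
  · have h0 : (0 : ℝ) < (Q : ℝ) - P := sub_pos.2 (by exact_mod_cast h')
    refine ⟨(x + 1) / ((Q : ℝ) - P), ?_⟩
    rw [mul_div_cancel₀ _ h0.ne']
    linarith

/-- The contours of `G^{m,n}_{p,q}` that occur when there are no loops around the left poles, with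
the change of argument counted by `φ + δ`, where `φ = 0` for left poles and `φ = -2π` for right
poles. -/
def IsRightContour (M N : ℕ) (a : Fin p → ℂ) (b : Fin q → ℂ) (ω : ℂ) (γ : ℝ → ℂ) (δ : ℝ) : Prop :=
  (∀ w ∈ leftPoles N a, ArgChange γ w (0 + δ)) ∧
    (∀ w ∈ rightPoles M b, ArgChange γ w (-(2 * Real.pi) + δ)) ∧
    ((IsVertical γ ∧ δ = Real.pi ∧
        0 < ((M : ℝ) + N - ((p : ℝ) + q) / 2) * Real.pi - |ω.im|) ∨
      (IsRightLoop γ ∧ δ = 0 ∧ (p < q ∨ ω.re < 0)))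

/-- Left loops would require more upper than lower parameters, or equality with `|z| > 1`; both are
excluded here. -/
theorem IsContour.exists_isRightContour {M N : ℕ} {a : Fin p → ℂ} {b : Fin q → ℂ} {ω : ℂ}
    {γ : ℝ → ℂ} (h : IsContour M N a b ω γ) (hpq : p ≤ q) (hω : p = q → ω.re ≤ 0) :
    ∃ δ, IsRightContour M N a b ω γ δ := by
  rcases h.2 with ⟨hv, -, him, hl, hr⟩ | ⟨hv, hc, hl, hr⟩ | ⟨-, hc, -⟩
  · refine ⟨Real.pi, by simpa using hl, fun w hw => ?_, Or.inl ⟨hv, rfl, by linarith⟩⟩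
    have := hr w hw
    rwa [show -(2 * Real.pi) + Real.pi = -Real.pi by ring]
  · refine ⟨0, by simpa using hl, by simpa using hr, Or.inr ⟨hv, rfl, ?_⟩⟩
    refine hc.imp_right fun hc => ?_
    have := hc.2.2
    rwa [Complex.norm_exp, Real.exp_lt_one_iff] at this
  · exfalso
    rcases hc with hc | ⟨h1, -, h2⟩
    · omega
    · rw [Complex.norm_exp, Real.one_lt_exp_iff] at h2
      linarith [hω h1]

theorem IsRightContour.converges {M N : ℕ} {a : Fin p → ℂ} {b : Fin q → ℂ} {ω : ℂ}
    {γ : ℝ → ℂ} {δ : ℝ} (h : IsRightContour M N a b ω γ δ) (hγ : IsPiecewiseC1 γ) (hpq : p ≤ q)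
    (hM : M ≤ q) (hN : N ≤ p) : Converges M N a b ω γ := by
  have hc : Continuous fun t => integrand M N a b ω (γ t) :=
    continuous_integrand_comp hγ.1.continuous (fun w hw => (h.1 w hw).1)
      fun w hw => (h.2.1 w hw).1
  rcases h.2.2 with ⟨hv, -, hκ⟩ | ⟨hv, -, hu⟩
  · refine integrable_vertical hκ ?_ hγ hv hc
    rw [neg_sub]
    exact highBound_integrand hpq hM hN a b ω
  · obtain ⟨K, hK⟩ := exists_sub_mul_neg hpq hu
    refine integrable_rightLoop hγ hv hc fun y ⟨T, hT⟩ => ?_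
    -- A ray at the height of `b l` would run through one of the poles `b l + r`, which the path
    -- avoids.
    have hy : ∀ l : Fin q, l.val < M → (b l).im ≠ y := by
      intro l hl hy
      obtain ⟨r, hr⟩ := exists_nat_ge (T - (b l).re)
      obtain ⟨t, ht⟩ := hT ((b l).re + r) (by linarith)
      refine (h.2.1 (b l + r) ⟨l, hl, r, rfl⟩).1 t ?_
      rw [ht]
      apply Complex.ext <;> simp [hy]
    obtain ⟨T', H⟩ := rowBound_integrand hpq hM hN a b ω hy K
    exact ⟨T', _, _, hK, H⟩

end MeijerG
end

/-! ### The common integrand and its partial fractions. -/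

noncomputable section
namespace MeijerG

open MeasureTheory Set Filter

variable {p q : ℕ}

/-- The common part of the integrands of `G^{m,n+1}` and `G^{m+1,n}`. -/
def commonFactor (m n : ℕ) (a : Fin p → ℂ) (b : Fin q → ℂ) : ℂ → ℂ → ℂ :=
  gammaQuotient {l | l.val < m} {l | m + 1 ≤ l.val} {l | l.val < n} {l | n + 1 ≤ l.val} a b

/-- The function `F` divided by the monic polynomial with roots `β, β + 1, …, β + k - 1`. -/
def divByRoots (F : ℂ → ℂ) (β : ℂ) (k : ℕ) (s : ℂ) : ℂ :=
  F s * (∏ i ∈ Finset.range k, (s - (β + i)))⁻¹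

theorem prod_val_lt_succ {n : ℕ} {i₀ : Fin p} (h : i₀.val = n) (f : Fin p → ℂ) :
    ∏ l : Fin p with l.val < n + 1, f l = f i₀ * ∏ l : Fin p with l.val < n, f l := by
  have : ({l | l.val < n + 1} : Finset (Fin p)) = insert i₀ ({l | l.val < n} : Finset (Fin p)) := by
    ext l
    simp only [Finset.mem_filter, Finset.mem_univ, true_and, Finset.mem_insert, Fin.ext_iff]
    omega
  rw [this, Finset.prod_insert (by simp [h])]

theorem prod_le_val {n : ℕ} {i₀ : Fin p} (h : i₀.val = n) (f : Fin p → ℂ) :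
    ∏ l : Fin p with n ≤ l.val, f l = f i₀ * ∏ l : Fin p with n + 1 ≤ l.val, f l := by
  have : ({l | n ≤ l.val} : Finset (Fin p)) =
      insert i₀ ({l | n + 1 ≤ l.val} : Finset (Fin p)) := by
    ext l
    simp only [Finset.mem_filter, Finset.mem_univ, true_and, Finset.mem_insert, Fin.ext_iff]
    omega
  rw [this, Finset.prod_insert (by simp [h])]

theorem Gamma_mul_inv_Gamma_add_nat {z : ℂ} (hz : ∀ r : ℕ, z ≠ -r) (k : ℕ) :
    Complex.Gamma z * (Complex.Gamma (z + k))⁻¹ = (∏ j ∈ Finset.range k, (z + j))⁻¹ := by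
  have h0 := Complex.Gamma_ne_zero hz
  have h1 := inv_Gamma_eq_prod_mul_inv_Gamma_add_nat z k
  have h2 : (∏ j ∈ Finset.range k, (z + j)) *
      (Complex.Gamma z * (Complex.Gamma (z + k))⁻¹) = 1 := by
    rw [mul_left_comm, ← h1, mul_inv_cancel₀ h0]
  exact (inv_eq_of_mul_eq_one_right h2).symm

/-- `Γ(z) / Γ(z + k)` with `z = 1 - a_{n+1} + s` is the reciprocal of `∏ (z + j)`, and `z + j = s -
(b_{m+1} + (k - 1 - j))`, hence the reversal of the product. Left poles are excluded because the
default values of Gamma there break the identity. -/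
theorem integrand_eq_divByRoots_left {m n k : ℕ} {a : Fin p → ℂ} {b : Fin q → ℂ} {i₀ : Fin p}
    {j₀ : Fin q} (hi : i₀.val = n) (hj : j₀.val = m) (hab : a i₀ - b j₀ = k) (ω : ℂ) {s : ℂ}
    (hs : s ∉ leftPoles (n + 1) a) :
    integrand m (n + 1) a b ω s = divByRoots (commonFactor m n a b ω) (b j₀) k s := by
  have hz : ∀ r : ℕ, 1 - a i₀ + s ≠ -r := fun r h =>
    hs ⟨i₀, by omega, r, by linear_combination h⟩
  have h1 := Gamma_mul_inv_Gamma_add_nat hz k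
  rw [show 1 - a i₀ + s + k = 1 - b j₀ + s by rw [← hab]; ring,
    ← Finset.prod_range_reflect] at h1
  have h2 : ∏ j ∈ Finset.range k, (1 - a i₀ + s + (k - 1 - j : ℕ)) =
      ∏ i ∈ Finset.range k, (s - (b j₀ + i)) := by
    refine Finset.prod_congr rfl fun j hj => ?_
    have := Finset.mem_range.1 hj
    rw [Nat.sub_sub, Nat.cast_sub (by omega), ← hab]
    push_cast
    ring
  rw [h2] at h1
  rw [divByRoots, commonFactor, integrand, gammaQuotient, prod_val_lt_succ hi, prod_le_val hj,
    ← h1]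
  simp only [div_eq_mul_inv, mul_inv]
  ring

/-- The same with `z = b_{m+1} - s`; each of the `k` factors now has the opposite sign. -/
theorem integrand_eq_divByRoots_right {m n k : ℕ} {a : Fin p → ℂ} {b : Fin q → ℂ} {i₀ : Fin p}
    {j₀ : Fin q} (hi : i₀.val = n) (hj : j₀.val = m) (hab : a i₀ - b j₀ = k) (ω : ℂ) {s : ℂ}
    (hs : s ∉ rightPoles (m + 1) b) :
    integrand (m + 1) n a b ω s =
      (-1) ^ k * divByRoots (commonFactor m n a b ω) (b j₀) k s := by
  have hz : ∀ r : ℕ, b j₀ - s ≠ -r := fun r h =>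
    hs ⟨j₀, by omega, r, by linear_combination -h⟩
  have h1 := Gamma_mul_inv_Gamma_add_nat hz k
  have h2 : ∏ j ∈ Finset.range k, (b j₀ - s + j) =
      (-1) ^ k * ∏ i ∈ Finset.range k, (s - (b j₀ + i)) := by
    rw [Finset.prod_congr rfl fun (j : ℕ) _ =>
      show b j₀ - s + (j : ℂ) = -1 * (s - (b j₀ + j)) by ring,
      Finset.prod_mul_distrib, Finset.prod_const, Finset.card_range]
  rw [show b j₀ - s + k = a i₀ - s by rw [← hab]; ring, h2, mul_inv, ← inv_pow,
    show (-1 : ℂ)⁻¹ = -1 by norm_num] at h1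
  rw [divByRoots, commonFactor, integrand, gammaQuotient, prod_val_lt_succ hj, prod_le_val hi]
  simp only [div_eq_mul_inv, mul_inv]
  linear_combination (Complex.exp (s * ω) * (∏ l : Fin q with l.val < m, Complex.Gamma (b l - s)) *
    (∏ l : Fin p with l.val < n, Complex.Gamma (1 - a l + s)) *
    (∏ l : Fin q with m + 1 ≤ l.val, Complex.Gamma (1 - b l + s))⁻¹ *
    (∏ l : Fin p with n + 1 ≤ l.val, Complex.Gamma (a l - s))⁻¹) * h1

/-- Lagrange interpolation of the constant 1 at the nodes `c i`; this needs at least one node. -/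
theorem inv_prod_sub_eq_sum {k : ℕ} (hk : 0 < k) {c : ℕ → ℂ} (hc : Function.Injective c) {s : ℂ}
    (hs : ∀ i < k, s ≠ c i) :
    (∏ i ∈ Finset.range k, (s - c i))⁻¹ =
      ∑ i ∈ Finset.range k, Lagrange.nodalWeight (Finset.range k) c i * (s - c i)⁻¹ := by
  have h1 := Lagrange.eval_interpolate_not_at_node (s := Finset.range k) (v := c)
    (r := (1 : ℕ → ℂ)) (x := s) (fun i hi => hs i (Finset.mem_range.1 hi))
  rw [Lagrange.interpolate_one hc.injOn ⟨0, Finset.mem_range.2 hk⟩, Polynomial.eval_one,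
    Lagrange.eval_nodal] at h1
  refine inv_eq_of_mul_eq_one_right ?_
  rw [h1]
  simp

/-- With `c i = β + i` and partial fraction coefficients `lam i`, write `F(s) / (s - c i) = dslope F
(c i) s + F(c i) / (s - c i)`. The slopes have poles only in `Z`, and the residue at `c i` is read
off as `lam i * F (c i)`. Residues on `Z` stay unspecified: they drop out when two weights agreeing
on `Z` are compared. -/
theorem exists_hasResidues_divByRoots {F : ℂ → ℂ} {Z : Set ℂ}
    (hF : ∀ s ∉ Z, DifferentiableAt ℂ F s) (hm : ∀ s, MeromorphicAt F s) {β : ℂ} {k : ℕ}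
    (hk : 0 < k) (hc : ∀ i < k, β + (i : ℂ) ∉ Z) {B X : ℝ} (hfin : (Z ∩ strip B (X + 1)).Finite)
    (hX : ∀ w ∈ Z, w.re ≠ X) (hB : ∀ i < k, -B < (β + (i : ℂ)).re)
    (hBX : ∀ i < k, (β + (i : ℂ)).re < X) :
    ∃ (X' : ℝ) (W : Finset ℂ) (ρ G : ℂ → ℂ), X < X' ∧
      HasResidues (divByRoots F β k) (strip B X') W ρ G ∧ (∀ w ∈ W, w.re < X) ∧
      (∀ w ∈ W, w ∈ Z ∨ ∃ i < k, w = β + (i : ℂ)) ∧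
      ∀ φ₁ φ₂ : ℂ → ℝ, (∀ w ∈ Z, φ₁ w = φ₂ w) →
        (∀ i < k, φ₁ (β + (i : ℂ)) = φ₂ (β + (i : ℂ)) + 2 * Real.pi) →
        ∑ w ∈ W, ρ w * (Complex.I * φ₁ w) - ∑ w ∈ W, ρ w * (Complex.I * φ₂ w) =
          2 * Real.pi * Complex.I * ∑ i ∈ Finset.range k,
            Lagrange.nodalWeight (Finset.range k) (fun i : ℕ => β + (i : ℂ)) i *
              F (β + (i : ℂ)) := by
  classical
  set c : ℕ → ℂ := fun i => β + (i : ℂ) with hcdef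
  have hinj : Function.Injective c := fun i j h => by simpa [hcdef] using h
  set lam := Lagrange.nodalWeight (Finset.range k) c with hlam
  -- The strip must reach slightly beyond the line `re s = X` without admitting new points of `Z`;
  -- finiteness leaves such a gap.
  obtain ⟨X', hXX', hX'1, hgap⟩ : ∃ X', X < X' ∧ X' ≤ X + 1 ∧
      ∀ w ∈ Z ∩ strip B (X + 1), w.re < X' → w.re < X := by
    have hcl : IsClosed (Complex.re '' (Z ∩ strip B (X + 1))) := (hfin.image _).isClosed
    have hn : (Complex.re '' (Z ∩ strip B (X + 1)))ᶜ ∈ 𝓝 X := hcl.isOpen_compl.mem_nhds (by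
      rintro ⟨w, hw, h⟩
      exact hX w hw.1 h)
    obtain ⟨ε, hε, hball⟩ := Metric.mem_nhds_iff.1 hn
    refine ⟨X + min ε 1, by linarith [lt_min hε one_pos], by linarith [min_le_right ε 1],
      fun w hw hlt => ?_⟩
    by_contra! hge
    refine hball ?_ ⟨w, hw, rfl⟩
    rw [Metric.mem_ball, Real.dist_eq, abs_of_nonneg (by linarith)]
    linarith [min_le_left ε 1]
  set S : Finset ℂ := hfin.toFinset.filter (fun w => w.re < X') with hS
  have hSmem : ∀ w, w ∈ S ↔ w ∈ Z ∧ w ∈ strip B (X + 1) ∧ w.re < X' := by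
    intro w; simp [hS, and_assoc]
  have hSZ : ∀ w ∈ S, w ∈ Z := fun w hw => ((hSmem w).1 hw).1
  have hUZ : ∀ s ∈ strip B X', s ∉ S → s ∉ Z := fun s hs hsS hsZ =>
    hsS ((hSmem s).2 ⟨hsZ, ⟨hs.1, hs.2.trans_le hX'1⟩, hs.2⟩)
  set C : Finset ℂ := (Finset.range k).map ⟨c, hinj⟩ with hC
  have hCmem : ∀ w, w ∈ C ↔ ∃ i < k, w = c i := by
    intro w; simp [hC, eq_comm]
  have hCZ : ∀ w ∈ C, w ∉ Z := by
    intro w hw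
    obtain ⟨i, hi, rfl⟩ := (hCmem w).1 hw
    exact hc i hi
  have hdisj : Disjoint S C := Finset.disjoint_left.2 fun w hw hw' => hCZ w hw' (hSZ w hw)
  have hUopen : IsOpen (strip B X') :=
    (isOpen_lt continuous_const Complex.continuous_re).inter
      (isOpen_lt Complex.continuous_re continuous_const)
  have hUconv : Convex ℝ (strip B X') :=
    (convex_halfSpace_re_gt _).inter (convex_halfSpace_re_lt _)
  set F' : ℂ → ℂ := fun s => ∑ i ∈ Finset.range k, lam i * dslope F (c i) s with hF'
  have hopen : IsOpen (strip B X' \ S) := hUopen.sdiff S.finite_toSet.isClosed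
  have hFd : DifferentiableOn ℂ F (strip B X' \ S) := fun s hs =>
    (hF s (hUZ s hs.1 hs.2)).differentiableWithinAt
  have hcU : ∀ i < k, c i ∈ strip B X' \ S := fun i hi =>
    ⟨⟨hB i hi, (hBX i hi).trans hXX'⟩, fun h => hc i hi (hSZ _ h)⟩
  have hF'd : DifferentiableOn ℂ F' (strip B X' \ S) := by
    refine DifferentiableOn.fun_sum fun i hi => DifferentiableOn.const_mul ?_ _
    exact (Complex.differentiableOn_dslope
      (hopen.mem_nhds (hcU i (Finset.mem_range.1 hi)))).2 hFd
  have hF'm : ∀ w ∈ S, MeromorphicAt F' w := by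
    intro w hw
    refine MeromorphicAt.fun_sum fun i hi => (MeromorphicAt.const _ _).fun_mul ?_
    have hne : w ≠ c i := fun h => hc i (Finset.mem_range.1 hi) (by
      have := hSZ w hw
      rwa [h] at this)
    have hquot : MeromorphicAt (fun s => (F s - F (c i)) / (s - c i)) w :=
      ((hm w).fun_sub (MeromorphicAt.const _ _)).fun_div
        ((MeromorphicAt.id w).fun_sub (MeromorphicAt.const _ _))
    refine hquot.congr ?_
    filter_upwards [mem_nhdsWithin_of_mem_nhds (isOpen_ne.mem_nhds hne)] with s hs
    rw [dslope_of_ne _ hs, slope_def_field]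
  obtain ⟨ρ₀, G, hG⟩ := exists_residues_primitive hUopen hUconv S F' hF'd hF'm
  -- One residue function on the disjoint sets `S` and `C`, glued along membership in `Z`.
  set ρ : ℂ → ℂ := fun w => if w ∈ Z then ρ₀ w else
    Function.extend c (fun i => lam i * F (c i)) 0 w with hρ
  have hρS : ∀ w ∈ S, ρ w = ρ₀ w := fun w hw => if_pos (hSZ w hw)
  have hρC : ∀ i < k, ρ (c i) = lam i * F (c i) := fun i hi =>
    (if_neg (hc i hi)).trans (hinj.extend_apply _ _ i)
  have hsum : ∀ f : ℂ → ℂ, ∑ w ∈ S ∪ C, ρ w * f w =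
      ∑ w ∈ S, ρ₀ w * f w + ∑ i ∈ Finset.range k, lam i * F (c i) * f (c i) := by
    intro f
    rw [Finset.sum_union hdisj, hC, Finset.sum_map]
    congr 1
    · exact Finset.sum_congr rfl fun w hw => by rw [hρS w hw]
    · exact Finset.sum_congr rfl fun i hi => by
        rw [Function.Embedding.coeFn_mk, hρC i (Finset.mem_range.1 hi)]
  have hnotmem : ∀ s ∈ strip B X' \ (S ∪ C : Finset ℂ), s ∉ S ∧ ∀ i < k, s ≠ c i := by
    intro s hs
    refine ⟨fun h => hs.2 (Finset.mem_coe.2 (Finset.mem_union_left _ h)), fun i hi h => hs.2 ?_⟩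
    exact Finset.mem_coe.2 (Finset.mem_union_right _ ((hCmem s).2 ⟨i, hi, h⟩))
  refine ⟨X', S ∪ C, ρ, G, hXX', ⟨fun s hs => ?_, fun s hs => ?_⟩, fun w hw => ?_,
    fun w hw => ?_, fun φ₁ φ₂ h₁ h₂ => ?_⟩
  · obtain ⟨hsS, hsC⟩ := hnotmem s hs
    refine ContinuousAt.continuousWithinAt (ContinuousAt.mul
      (hF s (hUZ s hs.1 hsS)).continuousAt (ContinuousAt.inv₀ (by fun_prop) ?_))
    exact Finset.prod_ne_zero_iff.2 fun i hi => sub_ne_zero.2 (hsC i (Finset.mem_range.1 hi))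
  · obtain ⟨hsS, hsC⟩ := hnotmem s hs
    refine (hG s ⟨hs.1, hsS⟩).congr_deriv ?_
    simp only [div_eq_mul_inv]
    rw [hsum, divByRoots, inv_prod_sub_eq_sum hk hinj hsC, hF', Finset.mul_sum, ← hlam]
    have e : ∀ i ∈ Finset.range k, lam i * dslope F (c i) s =
        F s * (lam i * (s - c i)⁻¹) - lam i * F (c i) * (s - c i)⁻¹ := by
      intro i hi
      rw [dslope_of_ne _ (hsC i (Finset.mem_range.1 hi)), slope_def_field]
      ring
    simp only [Finset.sum_congr rfl e, Finset.sum_sub_distrib]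
    ring
  · rcases Finset.mem_union.1 hw with hw | hw
    · obtain ⟨h1, h2, h3⟩ := (hSmem w).1 hw
      exact hgap w ⟨h1, h2⟩ h3
    · obtain ⟨i, hi, rfl⟩ := (hCmem w).1 hw
      exact hBX i hi
  · rcases Finset.mem_union.1 hw with hw | hw
    · exact Or.inl (hSZ w hw)
    · exact Or.inr ((hCmem w).1 hw)
  · rw [hsum fun w => Complex.I * φ₁ w, hsum fun w => Complex.I * φ₂ w,
      Finset.sum_congr rfl fun w hw => by rw [h₁ w (hSZ w hw)], add_sub_add_left_eq_sub,
      ← Finset.sum_sub_distrib, Finset.mul_sum]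
    refine Finset.sum_congr rfl fun i hi => ?_
    have := h₂ i (Finset.mem_range.1 hi)
    simp only [hcdef] at this ⊢
    rw [this]
    push_cast
    ring

end MeijerG
end

/-! ### Comparison of the two path integrals. -/

noncomputable section
namespace MeijerG

open MeasureTheory Set Filter

variable {p q : ℕ}

/-- Only countably many abscissae are forbidden. The lines `re s = x + N` then avoid all the points
`b l + r`. -/
theorem exists_forall_re_sub_ne_int (b : Fin q → ℂ) :
    ∃ x : ℝ, ∀ l, ∀ j : ℤ, (b l).re - x ≠ j := by
  have hc : (range fun lj : Fin q × ℤ => (b lj.1).re - lj.2).Countable := countable_range _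
  obtain ⟨x, hx⟩ := hc.dense_compl ℝ |>.nonempty
  exact ⟨x, fun l j h => hx ⟨(l, j), by simp only; linarith⟩⟩

theorem finite_leftPoles_inter (n : ℕ) (a : Fin p → ℂ) (B : ℝ) :
    (leftPoles n a ∩ {s | -B < s.re}).Finite := by
  obtain ⟨A, -, hA⟩ := exists_forall_le_of_fin fun l => (a l).re
  obtain ⟨R, hR⟩ := exists_nat_ge (A + B)
  refine ((finite_univ.prod (finite_Iio R)).image
    fun lr : Fin p × ℕ => a lr.1 - 1 - (lr.2 : ℂ)).subset ?_
  rintro s ⟨⟨l, -, r, rfl⟩, hs⟩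
  refine ⟨(l, r), ⟨mem_univ _, ?_⟩, rfl⟩
  simp only [mem_ofPred_eq, Complex.sub_re, Complex.one_re, Complex.natCast_re] at hs
  have : (r : ℝ) < R := by linarith [hA l]
  exact_mod_cast this

theorem finite_rightPoles_inter (m : ℕ) (b : Fin q → ℂ) (X : ℝ) :
    (rightPoles m b ∩ {s | s.re < X}).Finite := by
  obtain ⟨A, -, hA⟩ := exists_forall_le_of_fin fun l => -(b l).re
  obtain ⟨R, hR⟩ := exists_nat_ge (A + X)
  refine ((finite_univ.prod (finite_Iio R)).image
    fun lr : Fin q × ℕ => b lr.1 + (lr.2 : ℂ)).subset ?_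
  rintro s ⟨⟨l, -, r, rfl⟩, hs⟩
  refine ⟨(l, r), ⟨mem_univ _, ?_⟩, rfl⟩
  simp only [mem_ofPred_eq, Complex.add_re, Complex.natCast_re] at hs
  have : (r : ℝ) < R := by linarith [hA l]
  exact_mod_cast this

theorem IsRightContour.exists_lt_re {M N : ℕ} {a : Fin p → ℂ} {b : Fin q → ℂ} {ω : ℂ}
    {γ : ℝ → ℂ} {δ : ℝ} (h : IsRightContour M N a b ω γ δ) (hγ : Continuous γ) :
    ∃ B : ℝ, ∀ t, -B < (γ t).re := by
  rcases h.2.2 with ⟨hv, -⟩ | ⟨hv, -⟩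
  · obtain ⟨B, hB⟩ := hv.exists_abs_re_le hγ
    exact ⟨B + 1, fun t => by linarith [(abs_le.1 (hB t)).1]⟩
  · obtain ⟨B, hB⟩ := hv.exists_le_re hγ
    exact ⟨B + 1, fun t => by linarith [hB t]⟩

theorem integral_sub_integral_divByRoots {m n k : ℕ} {a : Fin p → ℂ} {b : Fin q → ℂ}
    {i₀ : Fin p} {j₀ : Fin q} (hi : i₀.val = n) (hj : j₀.val = m) (hab : a i₀ - b j₀ = k)
    (hk : 0 < k) (hsep : ∀ (i : Fin p) (j : Fin q), i.val ≤ n → j.val ≤ m →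
      ¬ (i.val = n ∧ j.val = m) → ∀ r : ℕ, 0 < r → a i - b j ≠ (r : ℂ))
    (hpq : p ≤ q) {ω : ℂ} {γ₁ γ₂ : ℝ → ℂ} {δ₁ δ₂ : ℝ}
    (hγ₁ : IsPiecewiseC1 γ₁) (hγ₂ : IsPiecewiseC1 γ₂)
    (h₁ : IsRightContour m (n + 1) a b ω γ₁ δ₁) (h₂ : IsRightContour (m + 1) n a b ω γ₂ δ₂)
    (hint₁ : Integrable fun t => divByRoots (commonFactor m n a b ω) (b j₀) k (γ₁ t) * deriv γ₁ t)
    (hint₂ : Integrable fun t =>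
      divByRoots (commonFactor m n a b ω) (b j₀) k (γ₂ t) * deriv γ₂ t) :
    (∫ t, divByRoots (commonFactor m n a b ω) (b j₀) k (γ₁ t) * deriv γ₁ t) -
      (∫ t, divByRoots (commonFactor m n a b ω) (b j₀) k (γ₂ t) * deriv γ₂ t) =
      2 * Real.pi * Complex.I * ∑ i ∈ Finset.range k,
        Lagrange.nodalWeight (Finset.range k) (fun i : ℕ => b j₀ + (i : ℂ)) i *
          commonFactor m n a b ω (b j₀ + (i : ℂ)) := by
  classical
  set F := commonFactor m n a b ω with hFdef
  set β := b j₀ with hβ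
  set g := divByRoots F β k with hg
  set Z : Set ℂ := leftPoles n a ∪ rightPoles m b with hZ
  set V := 2 * Real.pi * Complex.I * ∑ i ∈ Finset.range k,
    Lagrange.nodalWeight (Finset.range k) (fun i : ℕ => β + (i : ℂ)) i * F (β + (i : ℂ)) with hV
  have hiN : i₀.val ≤ n := hi.le
  have hjM : j₀.val ≤ m := hj.le
  have hFd : ∀ s ∉ Z, DifferentiableAt ℂ F s := fun s hs =>
    differentiableAt_gammaQuotient
      (fun l hl r h => hs (Or.inr ⟨l, by simpa using hl, r, h⟩))
      (fun l hl r h => hs (Or.inl ⟨l, by simpa using hl, r, h⟩))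
  have hFm : ∀ s, MeromorphicAt F s := meromorphicAt_gammaQuotient _ _ _ _ a b ω
  -- Each coincidence excluded here and in `hcr`, `hRL` would make some other difference `a i - b j`
  -- a positive integer, against `hsep`.
  have hcl : ∀ i < k, β + (i : ℂ) ∉ leftPoles n a := by
    rintro i - ⟨l, hl, r, h⟩
    refine hsep l j₀ hl.le hjM (by omega) (1 + r + i) (by omega) ?_
    push_cast
    linear_combination -h
  have hcr : ∀ i < k, β + (i : ℂ) ∉ rightPoles m b := by
    rintro i hik ⟨l, hl, r, h⟩
    refine hsep i₀ l hiN hl.le (by omega) (k - i + r) (by omega) ?_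
    rw [Nat.cast_add, Nat.cast_sub hik.le]
    linear_combination hab + h
  have hcL : ∀ i < k, β + (i : ℂ) ∈ leftPoles (n + 1) a := fun i hik =>
    ⟨i₀, by omega, k - 1 - i, by
      rw [Nat.sub_sub, Nat.cast_sub (by omega)]
      push_cast
      linear_combination -hab⟩
  have hcR : ∀ i < k, β + (i : ℂ) ∈ rightPoles (m + 1) b := fun i _ =>
    ⟨j₀, by omega, i, rfl⟩
  have hcZ : ∀ i < k, β + (i : ℂ) ∉ Z := fun i hik h => h.elim (hcl i hik) (hcr i hik)
  have hmonoL : leftPoles n a ⊆ leftPoles (n + 1) a := fun w ⟨l, hl, h⟩ => ⟨l, by omega, h⟩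
  have hmonoR : rightPoles m b ⊆ rightPoles (m + 1) b := fun w ⟨l, hl, h⟩ => ⟨l, by omega, h⟩
  have hRL : ∀ w ∈ rightPoles m b, w ∉ leftPoles (n + 1) a := by
    rintro w ⟨j, hj', r, rfl⟩ ⟨i, hi', r', h⟩
    refine hsep i j (by omega) hj'.le (by omega) (1 + r + r') (by omega) ?_
    push_cast
    linear_combination -h
  -- Normalized weights: 0 on left poles, `-2π` on the others that occur. They agree on `Z` and
  -- differ by `2π` exactly at the points `β + i`.
  set φ₁ : ℂ → ℝ := fun w => if w ∈ leftPoles (n + 1) a then 0 else -(2 * Real.pi) with hφ₁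
  set φ₂ : ℂ → ℝ := fun w => if w ∈ leftPoles n a then 0 else -(2 * Real.pi) with hφ₂
  have hφZ : ∀ w ∈ Z, φ₁ w = φ₂ w := by
    rintro w (hw | hw)
    · simp only [hφ₁, hφ₂, if_pos (hmonoL hw), if_pos hw]
    · simp only [hφ₁, hφ₂, if_neg (hRL w hw), if_neg fun h => hRL w hw (hmonoL h)]
  have hφC : ∀ i < k, φ₁ (β + (i : ℂ)) = φ₂ (β + (i : ℂ)) + 2 * Real.pi := by
    intro i hik
    simp only [hφ₁, hφ₂, if_pos (hcL i hik), if_neg (hcl i hik)]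
    ring
  have harg₁ : ∀ w, (w ∈ Z ∨ ∃ i < k, w = β + (i : ℂ)) → ArgChange γ₁ w (φ₁ w + δ₁) := by
    rintro w ((hw | hw) | ⟨i, hik, rfl⟩)
    · simp only [hφ₁, if_pos (hmonoL hw)]
      exact h₁.1 w (hmonoL hw)
    · simp only [hφ₁, if_neg (hRL w hw)]
      exact h₁.2.1 w hw
    · simp only [hφ₁, if_pos (hcL i hik)]
      exact h₁.1 _ (hcL i hik)
  have harg₂ : ∀ w, (w ∈ Z ∨ ∃ i < k, w = β + (i : ℂ)) → ArgChange γ₂ w (φ₂ w + δ₂) := by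
    rintro w ((hw | hw) | ⟨i, hik, rfl⟩)
    · simp only [hφ₂, if_pos hw]
      exact h₂.1 w hw
    · simp only [hφ₂, if_neg fun h => hRL w hw (hmonoL h)]
      exact h₂.2.1 w (hmonoR hw)
    · simp only [hφ₂, if_neg (hcl i hik)]
      exact h₂.2.1 _ (hcR i hik)
  obtain ⟨x, hx⟩ := exists_forall_re_sub_ne_int b
  obtain ⟨A, hA0, hA⟩ := exists_forall_le_of_fin fun l => (a l).re
  obtain ⟨A', hA0', hA'⟩ := exists_forall_le_of_fin fun l => |(a l).im|
  obtain ⟨B₁, hB₁⟩ := h₁.exists_lt_re hγ₁.1.continuous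
  obtain ⟨B₂, hB₂⟩ := h₂.exists_lt_re hγ₂.1.continuous
  set B := max (max B₁ B₂) (1 - β.re) with hB
  have hBγ₁ : ∀ t, -B < (γ₁ t).re := fun t => by
    linarith [hB₁ t, (le_max_left B₁ B₂).trans (le_max_left _ (1 - β.re))]
  have hBγ₂ : ∀ t, -B < (γ₂ t).re := fun t => by
    linarith [hB₂ t, (le_max_right B₁ B₂).trans (le_max_left _ (1 - β.re))]
  have hBc : ∀ i < k, -B < (β + (i : ℂ)).re := fun i _ => by
    have : (0 : ℝ) ≤ i := Nat.cast_nonneg i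
    simp only [Complex.add_re, Complex.natCast_re]
    linarith [le_max_right (max B₁ B₂) (1 - β.re)]
  have hat : Tendsto (fun N : ℕ => x + (N : ℝ)) atTop atTop :=
    tendsto_atTop_add_const_left _ x tendsto_natCast_atTop_atTop
  have hgM : (m : ℝ) ≤ q := by
    have := j₀.isLt
    exact_mod_cast (by omega : m ≤ q)
  have hM : m ≤ q := by exact_mod_cast hgM
  have hN : n + 1 ≤ p := by have := i₀.isLt; omega
  have hnotL : ∀ s : ℂ, (A ≤ s.re ∨ A' + 1 ≤ |s.im|) → s ∉ leftPoles (n + 1) a := by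
    rintro s hs ⟨l, -, r, rfl⟩
    have h0 : (0 : ℝ) ≤ r := Nat.cast_nonneg r
    rcases hs with hs | hs
    · simp only [Complex.sub_re, Complex.one_re, Complex.natCast_re] at hs
      linarith [hA l]
    · simp only [Complex.sub_im, Complex.one_im, Complex.natCast_im, sub_zero] at hs
      linarith [hA' l]
  set κ : ℝ := ((m : ℝ) + (n + 1 : ℕ) - ((p : ℝ) + q) / 2) * Real.pi - |ω.im| with hκ
  have hgH : HighBound g (-κ) := by
    have := highBound_integrand hpq hM hN a b ω
    rw [hκ, neg_sub]
    exact this.congr (Y₀ := A' + 1) fun s hs =>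
      (integrand_eq_divByRoots_left hi hj hab ω (hnotL s (Or.inr hs))).symm
  have hgL : ∀ K : ℝ, LineBound g x (ω.re - ((q : ℝ) - p) * K) (-κ) := by
    intro K
    have := lineBound_integrand hpq hM hN a b ω hx K
    rw [hκ, neg_sub]
    exact this.congr (X₀ := A) fun s hs =>
      (integrand_eq_divByRoots_left hi hj hab ω (hnotL s (Or.inl hs))).symm
  have hres : ∀ᶠ N : ℕ in atTop, ∃ (X' : ℝ) (W : Finset ℂ) (ρ G : ℂ → ℂ), x + N < X' ∧
      HasResidues g (strip B X') W ρ G ∧ (∀ w ∈ W, w.re < x + N) ∧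
      (∀ w ∈ W, ArgChange γ₁ w (φ₁ w + δ₁)) ∧ (∀ w ∈ W, ArgChange γ₂ w (φ₂ w + δ₂)) ∧
      ∑ w ∈ W, ρ w * (Complex.I * φ₁ w) - ∑ w ∈ W, ρ w * (Complex.I * φ₂ w) = V := by
    filter_upwards [hat.eventually_ge_atTop A, hat.eventually_ge_atTop (β.re + k)] with N hNA hNk
    have hfin : (Z ∩ strip B (x + N + 1)).Finite := by
      refine ((finite_leftPoles_inter n a B).union
        (finite_rightPoles_inter m b (x + N + 1))).subset ?_
      rintro w ⟨hw | hw, hs⟩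
      · exact Or.inl ⟨hw, hs.1⟩
      · exact Or.inr ⟨hw, hs.2⟩
    have hne : ∀ w ∈ Z, w.re ≠ x + N := by
      rintro w (hw | ⟨l, -, r, rfl⟩) h
      · exact hnotL w (Or.inl (h ▸ hNA)) (hmonoL hw)
      · refine hx l ((N : ℤ) - r) ?_
        simp only [Complex.add_re, Complex.natCast_re] at h
        push_cast
        linarith
    have hlt : ∀ i < k, (β + (i : ℂ)).re < x + N := by
      intro i hik
      have : (i : ℝ) < k := by exact_mod_cast hik
      simp only [Complex.add_re, Complex.natCast_re]
      linarith
    obtain ⟨X', W, ρ, G, e1, e2, e3, e4, e5⟩ :=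
      exists_hasResidues_divByRoots hFd hFm hk hcZ hfin hne hBc hlt
    exact ⟨X', W, ρ, G, e1, e2, e3, fun w hw => harg₁ w (e4 w hw),
      fun w hw => harg₂ w (e4 w hw), e5 φ₁ φ₂ hφZ hφC⟩
  -- If this holds, `g` decays to the right and the two paths may be of different kinds: both
  -- integrals are limits of residue sums over the same poles.
  by_cases hu : p < q ∨ ω.re < 0
  · obtain ⟨K, hK⟩ := exists_sub_mul_neg hpq hu
    have c₁ : ClosesToRight g γ₁ x δ₁ := by
      rcases h₁.2.2 with ⟨hv, rfl, hκ'⟩ | ⟨hv, rfl, -⟩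
      · exact closesToRight_of_isVertical hK hκ' hgH (hgL K) hγ₁ hv hint₁
      · exact closesToRight_of_isRightLoop hK (hgL K) hγ₁ hv hint₁
    have c₂ : ClosesToRight g γ₂ x δ₂ := by
      rcases h₂.2.2 with ⟨hv, rfl, hκ'⟩ | ⟨hv, rfl, -⟩
      · have hκ'' : 0 < κ := by
          rw [hκ]; push_cast at hκ' ⊢; linarith
        exact closesToRight_of_isVertical hK hκ'' hgH (hgL K) hγ₂ hv hint₂
      · exact closesToRight_of_isRightLoop hK (hgL K) hγ₂ hv hint₂
    obtain ⟨J₁, hJ₁, e₁⟩ := c₁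
    obtain ⟨J₂, hJ₂, e₂⟩ := c₂
    refine tendsto_nhds_unique (hJ₁.sub hJ₂) (tendsto_const_nhds.congr' ?_)
    filter_upwards [hres, e₁, e₂] with N hN' e₁ e₂
    obtain ⟨X', W, ρ, G, r1, r2, r3, r4, r5, r6⟩ := hN'
    rw [e₁ B X' W ρ G φ₁ r2 r1 r3 hBγ₁ r4, e₂ B X' W ρ G φ₂ r2 r1 r3 hBγ₂ r5, r6]
  -- Without decay to the right both paths must be vertical. Comparing each with the same line `re s
  -- = x + N` lets the line integral cancel, so no limit in `N` is needed.
  · obtain ⟨hv₁, rfl, hκ'⟩ := h₁.2.2.resolve_right fun h => hu h.2.2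
    obtain ⟨hv₂, rfl, -⟩ := h₂.2.2.resolve_right fun h => hu h.2.2
    obtain ⟨M₁, hM₁⟩ := hv₁.exists_abs_re_le hγ₁.1.continuous
    obtain ⟨M₂, hM₂⟩ := hv₂.exists_abs_re_le hγ₂.1.continuous
    obtain ⟨N, ⟨X', W, ρ, G, r1, r2, r3, r4, r5, r6⟩, hN₁, hN₂⟩ :=
      (hres.and ((hat.eventually_ge_atTop M₁).and (hat.eventually_ge_atTop M₂))).exists
    have e₁ := integral_vertical_sub_eq r2 r1 r3 hκ' hgH hγ₁ hv₁ hBγ₁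
      (fun t => ((abs_le.1 (hM₁ t)).2).trans hN₁) r4 hint₁
    have e₂ := integral_vertical_sub_eq r2 r1 r3 hκ' hgH hγ₂ hv₂ hBγ₂
      (fun t => ((abs_le.1 (hM₂ t)).2).trans hN₂) r5 hint₂
    rw [← r6, ← e₁, ← e₂]
    ring

end MeijerG
end

/-! ### Residues at the exceptional points and the formula when right closing is possible. -/

noncomputable section
namespace MeijerG

open MeasureTheory Set Filter

variable {p q : ℕ}

theorem prod_erase_range_sub (i d : ℕ) :
    ∏ j ∈ (Finset.range (i + 1 + d)).erase i, ((i : ℂ) - j) =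
      (-1) ^ d * (i.factorial * d.factorial) := by
  induction d with
  | zero =>
    rw [add_zero, Finset.range_add_one, Finset.erase_insert Finset.notMem_range_self,
      ← Finset.prod_range_reflect, ← Finset.prod_range_add_one_eq_factorial]
    push_cast
    rw [Nat.factorial_zero, pow_zero, one_mul, Nat.cast_one, mul_one]
    refine Finset.prod_congr rfl fun j hj => ?_
    have := Finset.mem_range.1 hj
    rw [Nat.sub_sub, Nat.cast_sub (by omega)]
    push_cast
    ring
  | succ d ih =>
    rw [← add_assoc, Finset.range_add_one, Finset.erase_insert_of_ne (by omega),
      Finset.prod_insert (by simp), ih, Nat.factorial_succ]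
    push_cast
    ring

/-- The `i` nodes below `β + i` contribute `i!`; the `k - 1 - i` nodes above contribute a factorial
and a sign each. This sign is the `(-1)^(a_{n+1} - 1 - c)` of the formula. -/
theorem nodalWeight_range_add_nat (β : ℂ) {k i : ℕ} (hi : i < k) :
    Lagrange.nodalWeight (Finset.range k) (fun i : ℕ => β + (i : ℂ)) i =
      (-1) ^ (k - 1 - i) * ((i.factorial : ℂ) * (k - 1 - i).factorial)⁻¹ := by
  obtain ⟨d, rfl⟩ := Nat.exists_eq_add_of_le (Nat.succ_le_of_lt hi)
  have h := prod_erase_range_sub i d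
  rw [show i.succ + d - 1 - i = d by omega, Lagrange.nodalWeight, Finset.prod_inv_distrib,
    Nat.succ_eq_add_one]
  simp only [add_sub_add_left_eq_sub]
  rw [h, mul_inv, ← inv_pow, inv_neg, inv_one]

/-- The term with index `i` on the right-hand side of the connection formula. -/
def residueTerm (m n k : ℕ) (a : Fin p → ℂ) (b : Fin q → ℂ) (ω c : ℂ) (i : ℕ) : ℂ :=
  (-1) ^ (k - 1 - i) *
    (((∏ l : Fin q with l.val < m, Complex.Gamma (b l - c)) *
        (∏ l : Fin p with l.val < n, Complex.Gamma (1 - a l + c))) /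
      ((∏ l : Fin q with m ≤ l.val, Complex.Gamma (1 - b l + c)) *
        (∏ l : Fin p with n ≤ l.val, Complex.Gamma (a l - c)))) *
    Complex.exp (c * ω)

/-- The two factorials are the values at `c` of `Γ(1 - b_{m+1} + s)` and `Γ(a_{n+1} - s)`, the
factors absent from the common part. -/
theorem nodalWeight_mul_commonFactor {m n k : ℕ} {a : Fin p → ℂ} {b : Fin q → ℂ} {i₀ : Fin p}
    {j₀ : Fin q} (hi : i₀.val = n) (hj : j₀.val = m) (hab : a i₀ - b j₀ = k) (ω : ℂ) {i : ℕ}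
    (hik : i < k) :
    Lagrange.nodalWeight (Finset.range k) (fun i : ℕ => b j₀ + (i : ℂ)) i *
        commonFactor m n a b ω (b j₀ + i) =
      residueTerm m n k a b ω (b j₀ + i) i := by
  have h1 : Complex.Gamma (1 - b j₀ + (b j₀ + i)) = i.factorial := by
    rw [← Complex.Gamma_nat_eq_factorial]; congr 1; ring
  have h2 : Complex.Gamma (a i₀ - (b j₀ + i)) = (k - 1 - i).factorial := by
    rw [← Complex.Gamma_nat_eq_factorial, Nat.sub_sub, Nat.cast_sub (by omega)]
    congr 1
    push_cast
    linear_combination hab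
  rw [nodalWeight_range_add_nat _ hik, residueTerm, prod_le_val hj, prod_le_val hi, h1, h2,
    commonFactor, gammaQuotient]
  simp only [div_eq_mul_inv, mul_inv]
  ring

theorem connection_of_le {m n k : ℕ} {a : Fin p → ℂ} {b : Fin q → ℂ}
    {i₀ : Fin p} {j₀ : Fin q} (hi : i₀.val = n) (hj : j₀.val = m) (hab : a i₀ - b j₀ = k)
    (hk : 0 < k) (hsep : ∀ (i : Fin p) (j : Fin q), i.val ≤ n → j.val ≤ m →
      ¬ (i.val = n ∧ j.val = m) → ∀ r : ℕ, 0 < r → a i - b j ≠ (r : ℂ))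
    {ω : ℂ} (hpq : p ≤ q) (hω : p = q → ω.re ≤ 0) {γ₁ γ₂ : ℝ → ℂ}
    (hγ₁ : IsContour m (n + 1) a b ω γ₁) (hγ₂ : IsContour (m + 1) n a b ω γ₂) :
    Converges m (n + 1) a b ω γ₁ ∧ Converges (m + 1) n a b ω γ₂ ∧
      meijerG m (n + 1) a b ω γ₁ - (-1) ^ k * meijerG (m + 1) n a b ω γ₂ =
        ∑ i ∈ Finset.range k, residueTerm m n k a b ω (b j₀ + i) i := by
  obtain ⟨δ₁, h₁⟩ := hγ₁.exists_isRightContour hpq hω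
  obtain ⟨δ₂, h₂⟩ := hγ₂.exists_isRightContour hpq hω
  have hi' := i₀.isLt
  have hj' := j₀.isLt
  have c₁ := h₁.converges hγ₁.1 hpq (by omega) (by omega)
  have c₂ := h₂.converges hγ₂.1 hpq (by omega) (by omega)
  refine ⟨c₁, c₂, ?_⟩
  have hsq : ((-1 : ℂ) ^ k) * (-1) ^ k = 1 := by
    rw [← mul_pow]; norm_num
  have e₁ : (fun t => integrand m (n + 1) a b ω (γ₁ t) * deriv γ₁ t) =
      fun t => divByRoots (commonFactor m n a b ω) (b j₀) k (γ₁ t) * deriv γ₁ t := by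
    funext t
    rw [integrand_eq_divByRoots_left hi hj hab ω fun h => (h₁.1 _ h).1 t rfl]
  have e₂ : (fun t => (-1) ^ k * (integrand (m + 1) n a b ω (γ₂ t) * deriv γ₂ t)) =
      fun t => divByRoots (commonFactor m n a b ω) (b j₀) k (γ₂ t) * deriv γ₂ t := by
    funext t
    rw [integrand_eq_divByRoots_right hi hj hab ω fun h => (h₂.2.1 _ h).1 t rfl, mul_assoc,
      ← mul_assoc, hsq, one_mul]
  have hint₁ := c₁
  -- The second integrand is `(-1)^k` times the common function, so multiplying by the same sign
  -- recovers that function.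
  have hint₂ := c₂.const_mul ((-1 : ℂ) ^ k)
  rw [Converges, e₁] at hint₁
  rw [e₂] at hint₂
  have key := integral_sub_integral_divByRoots hi hj hab hk hsep hpq hγ₁.1 hγ₂.1 h₁ h₂ hint₁ hint₂
  rw [← e₁, ← e₂, integral_const_mul, Finset.sum_congr rfl fun i hi' =>
    nodalWeight_mul_commonFactor hi hj hab ω (Finset.mem_range.1 hi')] at key
  rw [meijerG, meijerG, mul_left_comm, ← mul_sub, key, inv_mul_cancel_left₀ Complex.two_pi_I_ne_zero]

end MeijerG
end

/-! ### Reflection `s ↦ -s`. -/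

noncomputable section
namespace MeijerG

open MeasureTheory Set Filter

variable {p q : ℕ}

/-- The image of a curve under `s ↦ -s`, with the reversed orientation. -/
def negReverse (γ : ℝ → ℂ) (t : ℝ) : ℂ := -γ (-t)

variable {γ : ℝ → ℂ}

/-- The signs from the reflection and from the reversal cancel; hence `meijerG` acquires no sign. -/
theorem deriv_negReverse (γ : ℝ → ℂ) (t : ℝ) : deriv (negReverse γ) t = deriv γ (-t) := by
  change deriv (fun t => -γ (-t)) t = _
  rw [deriv.fun_neg, deriv_comp_neg γ t, neg_neg]

theorem IsPiecewiseC1.negReverse (h : IsPiecewiseC1 γ) : IsPiecewiseC1 (negReverse γ) := by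
  obtain ⟨hl, S, hS, hd⟩ := h
  refine ⟨?_, -S, hS.neg, fun t ht => ?_⟩
  · intro t
    obtain ⟨K, U, hU, hK⟩ := hl (-t)
    refine ⟨K, (fun t => -t) ⁻¹' U, (continuous_neg.tendsto t).eventually hU, fun x hx y hy => ?_⟩
    have := hK hx hy
    simpa [MeijerG.negReverse, edist_neg_neg] using this
  · exact ((hd (-t) (by simpa using ht)).comp t contDiff_neg.contDiffAt).neg

theorem ArgChange.negReverse {w : ℂ} {θ : ℝ} (h : ArgChange γ w θ) :
    ArgChange (negReverse γ) (-w) (-θ) := by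
  refine ⟨fun t ht => h.1 (-t) (neg_injective ht), (h.2.neg).congr fun R => ?_⟩
  have e : ∀ t : ℝ, deriv (MeijerG.negReverse γ) t / (MeijerG.negReverse γ t - -w) =
      -(deriv γ (-t) / (γ (-t) - w)) := by
    intro t
    rw [deriv_negReverse, MeijerG.negReverse, ← neg_sub', div_neg]
  simp only [e]
  rw [intervalIntegral.integral_neg,
    intervalIntegral.integral_comp_neg fun t => deriv γ t / (γ t - w), neg_neg, Complex.neg_im]

theorem IsVertical.negReverse (h : IsVertical γ) : IsVertical (negReverse γ) := by
  obtain ⟨x₁, x₂, T, h₁, h₂⟩ := h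
  refine ⟨-x₂, -x₁, T, fun t ht => ?_, fun t ht => ?_⟩
  · rw [MeijerG.negReverse, h₂ _ (by linarith)]; push_cast; ring
  · rw [MeijerG.negReverse, h₁ _ (by linarith)]; push_cast; ring

theorem IsRightLoop.negReverse (h : IsRightLoop γ) : IsLeftLoop (negReverse γ) := by
  obtain ⟨y₁, y₂, T, h₁, h₂⟩ := h
  refine ⟨-y₂, -y₁, T, fun t ht => ?_, fun t ht => ?_⟩
  · rw [MeijerG.negReverse, h₂ _ (by linarith)]; push_cast; ring
  · rw [MeijerG.negReverse, h₁ _ (by linarith)]; push_cast; ring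

theorem IsLeftLoop.negReverse (h : IsLeftLoop γ) : IsRightLoop (negReverse γ) := by
  obtain ⟨y₁, y₂, T, h₁, h₂⟩ := h
  refine ⟨-y₂, -y₁, T, fun t ht => ?_, fun t ht => ?_⟩
  · rw [MeijerG.negReverse, h₂ _ (by linarith)]; push_cast; ring
  · rw [MeijerG.negReverse, h₁ _ (by linarith)]; push_cast; ring

theorem neg_mem_rightPoles {n : ℕ} {a : Fin p → ℂ} {w : ℂ}
    (h : w ∈ rightPoles n fun l => 1 - a l) : -w ∈ leftPoles n a := by
  obtain ⟨l, hl, r, rfl⟩ := h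
  exact ⟨l, hl, r, by ring⟩

theorem neg_mem_leftPoles {m : ℕ} {b : Fin q → ℂ} {w : ℂ}
    (h : w ∈ leftPoles m fun l => 1 - b l) : -w ∈ rightPoles m b := by
  obtain ⟨l, hl, r, rfl⟩ := h
  exact ⟨l, hl, r, by ring⟩

theorem integrand_reflect (m n : ℕ) (a : Fin p → ℂ) (b : Fin q → ℂ) (ω s : ℂ) :
    integrand n m (fun l => 1 - b l) (fun l => 1 - a l) (-ω) s = integrand m n a b ω (-s) := by
  simp only [integrand, sub_sub_cancel]
  rw [mul_comm (∏ l : Fin p with l.val < n, _), mul_comm (∏ l : Fin p with n ≤ l.val, _)]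
  simp only [show ∀ x : ℂ, 1 - x - s = 1 - x + -s from fun x => by ring,
    show ∀ x : ℂ, x + s = x - -s from fun x => by ring, mul_neg, neg_mul]

/-- Left and right poles, and left and right loops, change places, all argument changes reverse
sign, and `|z|` becomes `1/|z|`. A vertical path still runs upwards because it is also reversed. -/
theorem IsContour.reflect {m n : ℕ} {a : Fin p → ℂ} {b : Fin q → ℂ} {ω : ℂ}
    (h : IsContour m n a b ω γ) :
    IsContour n m (fun l => 1 - b l) (fun l => 1 - a l) (-ω) (negReverse γ) := by
  have hexp : ‖Complex.exp (-ω)‖ = ‖Complex.exp ω‖⁻¹ := by rw [Complex.exp_neg, norm_inv]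
  refine ⟨h.1.negReverse, ?_⟩
  have hl : ∀ θ, (∀ w ∈ leftPoles n a, ArgChange γ w θ) →
      ∀ w ∈ rightPoles n fun l => 1 - a l, ArgChange (negReverse γ) w (-θ) := by
    intro θ h w hw
    simpa using (h _ (neg_mem_rightPoles hw)).negReverse
  have hr : ∀ θ, (∀ w ∈ rightPoles m b, ArgChange γ w θ) →
      ∀ w ∈ leftPoles m fun l => 1 - b l, ArgChange (negReverse γ) w (-θ) := by
    intro θ h w hw
    simpa using (h _ (neg_mem_leftPoles hw)).negReverse
  rcases h.2 with ⟨hv, h1, h2, h3, h4⟩ | ⟨hv, h1, h3, h4⟩ | ⟨hv, h1, h3, h4⟩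
  · refine Or.inl ⟨hv.negReverse, by omega, ?_, by simpa using hr _ h4, hl _ h3⟩
    rw [Complex.neg_im, abs_neg, add_comm (n : ℝ), add_comm (q : ℝ)]
    exact h2
  · refine Or.inr (Or.inr ⟨hv.negReverse, h1.imp_right ?_, by simpa using hr _ h4,
      by simpa using hl _ h3⟩)
    rintro ⟨h5, h6, h7⟩
    rw [hexp]
    exact ⟨h5.symm, h5 ▸ h6, (one_lt_inv₀ (norm_pos_iff.2 (Complex.exp_ne_zero _))).2 h7⟩
  · refine Or.inr (Or.inl ⟨hv.negReverse, h1.imp_right ?_, by simpa using hr _ h4,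
      by simpa using hl _ h3⟩)
    rintro ⟨h5, h6, h7⟩
    rw [hexp]
    exact ⟨h5.symm, h5 ▸ h6, inv_lt_one_of_one_lt₀ h7⟩

theorem integrand_mul_deriv_negReverse (m n : ℕ) (a : Fin p → ℂ) (b : Fin q → ℂ) (ω : ℂ)
    (γ : ℝ → ℂ) (t : ℝ) :
    integrand n m (fun l => 1 - b l) (fun l => 1 - a l) (-ω) (negReverse γ t) *
      deriv (negReverse γ) t = integrand m n a b ω (γ (-t)) * deriv γ (-t) := by
  rw [integrand_reflect, deriv_negReverse, negReverse, neg_neg]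

theorem converges_reflect {m n : ℕ} {a : Fin p → ℂ} {b : Fin q → ℂ} {ω : ℂ}
    (h : Converges n m (fun l => 1 - b l) (fun l => 1 - a l) (-ω) (negReverse γ)) :
    Converges m n a b ω γ := by
  have := Integrable.comp_neg h
  simp only [integrand_mul_deriv_negReverse, neg_neg] at this
  exact this

theorem meijerG_reflect (m n : ℕ) (a : Fin p → ℂ) (b : Fin q → ℂ) (ω : ℂ) (γ : ℝ → ℂ) :
    meijerG n m (fun l => 1 - b l) (fun l => 1 - a l) (-ω) (negReverse γ) =
      meijerG m n a b ω γ := by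
  simp only [meijerG, integrand_mul_deriv_negReverse]
  rw [integral_neg_eq_self fun t => integrand m n a b ω (γ t) * deriv γ t]

end MeijerG
end

/-! ### The connection formula in all cases. -/

noncomputable section
namespace MeijerG

variable {p q : ℕ}

/-- Reflection lists the points in the opposite order, `i ↦ k - 1 - i`; the prefactor `-(-1)^k`
turns the sign `(-1)^(k-1-i)` into `(-1)^i`. -/
theorem residueTerm_reflect (m n : ℕ) (a : Fin p → ℂ) (b : Fin q → ℂ) (ω c : ℂ) {i k : ℕ}
    (hik : i < k) :
    -(-1) ^ k * residueTerm n m k (fun l => 1 - b l) (fun l => 1 - a l) (-ω) (-c) i =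
      residueTerm m n k a b ω c (k - 1 - i) := by
  obtain ⟨d, rfl⟩ := Nat.exists_eq_add_of_le (Nat.succ_le_of_lt hik)
  have h := integrand_reflect m n a b ω (-c)
  rw [neg_neg, integrand, integrand, mul_comm, mul_comm (Complex.exp (c * ω))] at h
  rw [residueTerm, residueTerm, mul_assoc ((-1 : ℂ) ^ _), h, mul_assoc ((-1 : ℂ) ^ (_ - 1 - _)),
    show i.succ + d - 1 - i = d by omega, show i.succ + d - 1 - d = i by omega, ← mul_assoc]
  congr 1
  have hd : (-1 : ℂ) ^ d * (-1) ^ d = 1 := by rw [← mul_pow]; norm_num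
  rw [Nat.succ_eq_add_one, pow_add, pow_add]
  linear_combination (-1 : ℂ) ^ i * hd

theorem connection_formula {m n k : ℕ} {a : Fin p → ℂ} {b : Fin q → ℂ}
    {i₀ : Fin p} {j₀ : Fin q} (hi : i₀.val = n) (hj : j₀.val = m) (hab : a i₀ - b j₀ = k)
    (hk : 0 < k) (hsep : ∀ (i : Fin p) (j : Fin q), i.val ≤ n → j.val ≤ m →
      ¬ (i.val = n ∧ j.val = m) → ∀ r : ℕ, 0 < r → a i - b j ≠ (r : ℂ))
    {ω : ℂ} {γ₁ γ₂ : ℝ → ℂ}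
    (hγ₁ : IsContour m (n + 1) a b ω γ₁) (hγ₂ : IsContour (m + 1) n a b ω γ₂) :
    Converges m (n + 1) a b ω γ₁ ∧ Converges (m + 1) n a b ω γ₂ ∧
      meijerG m (n + 1) a b ω γ₁ - (-1) ^ k * meijerG (m + 1) n a b ω γ₂ =
        ∑ i ∈ Finset.range k, residueTerm m n k a b ω (b j₀ + i) i := by
  by_cases h : p ≤ q ∧ (p = q → ω.re ≤ 0)
  · exact connection_of_le hi hj hab hk hsep h.1 h.2 hγ₁ hγ₂
  · have hqp : q ≤ p := by
      by_contra hlt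
      exact h ⟨by omega, fun h => by omega⟩
    have hω : q = p → (-ω).re ≤ 0 := by
      rintro rfl
      by_contra! hlt
      rw [Complex.neg_re] at hlt
      exact h ⟨le_rfl, fun _ => by linarith⟩
    obtain ⟨c₂, c₁, e⟩ := connection_of_le (i₀ := j₀) (j₀ := i₀) (a := fun l => 1 - b l)
      (b := fun l => 1 - a l) hj hi (by rw [sub_sub_sub_cancel_left, hab]) hk
      (fun j i hj' hi' hne r hr => by
        rw [sub_sub_sub_cancel_left]
        exact hsep i j hi' hj' (fun h => hne h.symm) r hr) hqp hω hγ₂.reflect hγ₁.reflect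
    refine ⟨converges_reflect c₁, converges_reflect c₂, ?_⟩
    rw [meijerG_reflect, meijerG_reflect] at e
    have hsq : ((-1 : ℂ) ^ k) * (-1) ^ k = 1 := by
      rw [← mul_pow]; norm_num
    rw [← Finset.sum_range_reflect]
    -- The reflected identity has the two functions in exchanged roles; multiplication by `-(-1)^k`
    -- restores them, as `((-1)^k)² = 1`.
    calc _ = -(-1) ^ k * (meijerG (m + 1) n a b ω γ₂ -
          (-1) ^ k * meijerG m (n + 1) a b ω γ₁) := by
          linear_combination (-meijerG m (n + 1) a b ω γ₁) * hsq
      _ = _ := by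
        rw [e, Finset.mul_sum]
        refine Finset.sum_congr rfl fun i hi' => ?_
        have hik := Finset.mem_range.1 hi'
        rw [← residueTerm_reflect m n a b ω _ hik]
        congr 2
        rw [Nat.sub_sub, Nat.cast_sub (by omega)]
        push_cast
        linear_combination -hab

end MeijerG
end

/-- Let `a_{n+1} - b_{m+1} = k` be a positive integer, while `a_i - b_j` is not a positive integer
for all other `i ≤ n + 1`, `j ≤ m + 1`. For `z = exp ω`, and whatever integration paths `γ₁`, `γ₂`
are used for the two `G`-functions, both integrals converge and
`G^{m,n+1}_{p+1,q+1}(z) - (-1)^k G^{m+1,n}_{p+1,q+1}(z)` is the sum over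
`c = b_{m+1}, b_{m+1} + 1, …, a_{n+1} - 1` of the terms below. -/
theorem propositionA1 (p q m n : ℕ) (hn : n ≤ p) (hm : m ≤ q)
    (a : Fin (p + 1) → ℂ) (b : Fin (q + 1) → ℂ)
    (k : ℕ) (hk : 0 < k)
    (hab : a ⟨n, Nat.lt_succ_of_le hn⟩ - b ⟨m, Nat.lt_succ_of_le hm⟩ = (k : ℂ))
    (hsep : ∀ (i : Fin (p + 1)) (j : Fin (q + 1)), i.val ≤ n → j.val ≤ m →
      ¬ (i.val = n ∧ j.val = m) → ∀ r : ℕ, 0 < r → a i - b j ≠ (r : ℂ))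
    (ω : ℂ) (γ₁ γ₂ : ℝ → ℂ)
    (hγ₁ : MeijerG.IsContour m (n + 1) a b ω γ₁)
    (hγ₂ : MeijerG.IsContour (m + 1) n a b ω γ₂) :
    MeijerG.Converges m (n + 1) a b ω γ₁ ∧
    MeijerG.Converges (m + 1) n a b ω γ₂ ∧
    MeijerG.meijerG m (n + 1) a b ω γ₁ - (-1) ^ k * MeijerG.meijerG (m + 1) n a b ω γ₂ =
      ∑ i ∈ Finset.range k,
        let c : ℂ := b ⟨m, Nat.lt_succ_of_le hm⟩ + (i : ℂ)
        (-1) ^ (k - 1 - i) *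
          (((∏ l : Fin (q + 1) with l.val < m, Complex.Gamma (b l - c)) *
              (∏ l : Fin (p + 1) with l.val < n, Complex.Gamma (1 - a l + c))) /
            ((∏ l : Fin (q + 1) with m ≤ l.val, Complex.Gamma (1 - b l + c)) *
              (∏ l : Fin (p + 1) with n ≤ l.val, Complex.Gamma (a l - c)))) *
          Complex.exp (c * ω) :=
  MeijerG.connection_formula rfl rfl hab hk hsep hγ₁ hγ₂
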